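/- Let $M_+(\mathbb{R})$ be the commutative convolution ring of real Radon measures on $\mathbb{R}$ whose support is bounded on the left, and let $M(\mathbb{R}_-)$ be the set of those with compact support contained in $\mathbb{R}_-=(-\infty,0]$. Products of matrices over $M_+(\mathbb{R})$, and determinants, are taken with respect to the convolution $*$. For $\alpha\in M_+(\mathbb{R})$ put $l(\alpha)=\inf\operatorname{supp}\alpha$, and let $\pi(\alpha)$ be the restriction of the distribution $\alpha$ to the $C^\infty$ functions on $\mathbb{R}$ with compact support contained in $\mathbb{R}_+=[0,\infty)$. A locally integrable function $f$ is identified with the measure $f(t)\,dt$, and functions on $\mathbb{R}_+$ or on $[-T,0]$ are extended by zero to $\mathbb{R}$. A pseudo-rational system of order zero $\Sigma^Q$ is given by a $d\times d$ matrix $Q$ and a $d\times m$ matrix $P$ with entries in $M(\mathbb{R}_-)$ such that $Q$ has a convolution inverse $Q^{-1}$ with entries in $M_+(\mathbb{R})$, that is, $Q^{-1}*Q=Q*Q^{-1}=\delta_0 I_d$; its output for the input $u$ is $\pi(Q^{-1}*P*u)$. Its state space is $$X^{Q,1}=\{y\in L^1_{\rm loc}(\mathbb{R}_+,\mathbb{R})^d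 : \pi(Q*y)=0\}.$$ The system is $X^{Q,1}$-reachable in time $T$ if for every $y\in X^{Q,1}$ there is $u\in L^1([-T,0],\mathbb{R})^m$ with $\pi(Q^{-1}*P*u)=y$. It is left-coprime if there are a $d\times d$ matrix $R$ and an $m\times d$ matrix $S$ with entries in $M(\mathbb{R}_-)$ such that $Q*R+P*S=\delta_0 I_d$. Theorem. Let $\Sigma^Q$ be a pseudo-rational system of order zero and let $T>-l(\det Q)$. Then $\Sigma^Q$ is $X^{Q,1}$-reachable in time $T$ if and only if it is left-coprime. -/

import Mathlib

open MeasureTheory Set Distributions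

/-! ### Real Radon measures on the line whose support is bounded on the left

Positive Radon measures on `ℝ` with support bounded on the left form a cancellative commutative
semiring for addition and convolution.  The real (signed) ones are the differences of two positive
ones: pairs `(μ, ν)`, standing for `μ - ν`, modulo `(μ, ν) ∼ (μ', ν') ↔ μ + ν' = μ' + ν`.
They form a commutative ring for addition and convolution, with unit `δ₀`. -/

/-- Positive Radon (i.e. locally finite Borel) measures on `ℝ` with support bounded on the left. -/
@[ext]
structure PosRadon where
  /-- the underlying Borel measure -/
  toMeasure : Measure ℝ
  locallyFinite : IsLocallyFiniteMeasure toMeasure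
  bddLeft : ∃ a : ℝ, toMeasure (Iio a) = 0

namespace PosRadon

instance (μ : PosRadon) : IsLocallyFiniteMeasure μ.toMeasure := μ.locallyFinite

theorem conv_bddLeft {μ ν : Measure ℝ} [SFinite μ] [SFinite ν] {a b : ℝ}
    (ha : μ (Iio a) = 0) (hb : ν (Iio b) = 0) : (μ.conv ν) (Iio (a + b)) = 0 := by
  rw [Measure.conv, Measure.map_apply (by fun_prop) measurableSet_Iio]
  refine measure_mono_null (t := (Iio a ×ˢ univ) ∪ (univ ×ˢ Iio b)) ?_ ?_
  · rintro ⟨x, y⟩ h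
    simp only [mem_preimage, mem_Iio] at h
    simp only [mem_union, mem_prod, mem_Iio, mem_univ, and_true, true_and]
    by_contra! hc
    linarith
  · rw [measure_union_null_iff, Measure.prod_prod, Measure.prod_prod, ha, hb]
    simp

theorem conv_locallyFinite {μ ν : Measure ℝ} [IsLocallyFiniteMeasure μ]
    [IsLocallyFiniteMeasure ν] {a b : ℝ}
    (ha : μ (Iio a) = 0) (hb : ν (Iio b) = 0) : IsLocallyFiniteMeasure (μ.conv ν) := by
  have key : ∀ c : ℝ, (μ.conv ν) (Iio c) < ⊤ := by
    intro c
    rw [Measure.conv, Measure.map_apply (by fun_prop) measurableSet_Iio]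
    refine lt_of_le_of_lt (measure_mono (t := ((Iio a ×ˢ univ) ∪ (univ ×ˢ Iio b)) ∪
      (Icc a (c - b) ×ˢ Icc b (c - a))) ?_) ?_
    · rintro ⟨x, y⟩ h
      simp only [mem_preimage, mem_Iio] at h
      simp only [mem_union, mem_prod, mem_Iio, mem_univ, and_true, true_and, mem_Icc]
      by_contra! hc
      obtain ⟨⟨h1, h2⟩, h3⟩ := hc
      have := h3 ⟨h1, by linarith⟩ h2
      linarith
    · refine lt_of_le_of_lt (measure_union_le _ _) ?_
      have h0 : (μ.prod ν) ((Iio a ×ˢ univ) ∪ (univ ×ˢ Iio b)) = 0 := by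
        rw [measure_union_null_iff, Measure.prod_prod, Measure.prod_prod, ha, hb]
        simp
      rw [h0, zero_add, Measure.prod_prod]
      exact ENNReal.mul_lt_top isCompact_Icc.measure_lt_top isCompact_Icc.measure_lt_top
  exact ⟨fun x => ⟨Iio (x + 1), Iio_mem_nhds (by linarith), key _⟩⟩

instance : Zero PosRadon := ⟨⟨0, inferInstance, 0, by simp⟩⟩

noncomputable instance : One PosRadon := ⟨⟨Measure.dirac 0, inferInstance, 0, by simp⟩⟩

instance : Add PosRadon := ⟨fun μ ν => ⟨μ.toMeasure + ν.toMeasure, ⟨fun x => by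
  obtain ⟨s, hs, h1⟩ := μ.toMeasure.finiteAt_nhds x
  obtain ⟨t, ht, h2⟩ := ν.toMeasure.finiteAt_nhds x
  refine ⟨s ∩ t, Filter.inter_mem hs ht, ?_⟩
  rw [Measure.add_apply]
  exact ENNReal.add_lt_top.2 ⟨(measure_mono inter_subset_left).trans_lt h1,
    (measure_mono inter_subset_right).trans_lt h2⟩⟩, by
  obtain ⟨a, ha⟩ := μ.bddLeft
  obtain ⟨b, hb⟩ := ν.bddLeft
  refine ⟨min a b, ?_⟩
  have h1 := measure_mono_null (Iio_subset_Iio (min_le_left a b)) ha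
  have h2 := measure_mono_null (Iio_subset_Iio (min_le_right a b)) hb
  simp [h1, h2]⟩⟩

/-- The product is the convolution of measures. -/
noncomputable instance : Mul PosRadon := ⟨fun μ ν => ⟨μ.toMeasure.conv ν.toMeasure, by
  obtain ⟨a, ha⟩ := μ.bddLeft
  obtain ⟨b, hb⟩ := ν.bddLeft
  exact conv_locallyFinite ha hb, by
  obtain ⟨a, ha⟩ := μ.bddLeft
  obtain ⟨b, hb⟩ := ν.bddLeft
  exact ⟨a + b, conv_bddLeft ha hb⟩⟩⟩

@[simp] theorem toMeasure_zero : (0 : PosRadon).toMeasure = 0 := rfl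
@[simp] theorem toMeasure_one : (1 : PosRadon).toMeasure = Measure.dirac 0 := rfl
@[simp] theorem toMeasure_add (μ ν : PosRadon) :
    (μ + ν).toMeasure = μ.toMeasure + ν.toMeasure := rfl
@[simp] theorem toMeasure_mul (μ ν : PosRadon) :
    (μ * ν).toMeasure = μ.toMeasure.conv ν.toMeasure := rfl

noncomputable instance : CommSemiring PosRadon where
  nsmul := nsmulRec
  add_assoc _ _ _ := PosRadon.ext (add_assoc _ _ _)
  zero_add _ := PosRadon.ext (zero_add _)
  add_zero _ := PosRadon.ext (add_zero _)
  add_comm _ _ := PosRadon.ext (add_comm _ _)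
  left_distrib _ _ _ := PosRadon.ext (Measure.conv_add _ _ _)
  right_distrib _ _ _ := PosRadon.ext (Measure.add_conv _ _ _)
  zero_mul _ := PosRadon.ext (Measure.zero_conv _)
  mul_zero _ := PosRadon.ext (Measure.conv_zero _)
  mul_assoc _ _ _ := PosRadon.ext (Measure.conv_assoc _ _ _)
  one_mul _ := PosRadon.ext (Measure.dirac_zero_conv _)
  mul_one _ := PosRadon.ext (Measure.conv_dirac_zero _)
  mul_comm _ _ := PosRadon.ext (Measure.conv_comm _ _)

theorem add_right_cancel' {μ ν κ : PosRadon} (h : μ + κ = ν + κ) : μ = ν := by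
  refine PosRadon.ext (Measure.ext_of_Ioc _ _ fun a b _ => ?_)
  have h' := congrArg (fun ρ : PosRadon => ρ.toMeasure (Ioc a b)) h
  simp only [toMeasure_add, Measure.add_apply] at h'
  exact (ENNReal.add_left_inj measure_Ioc_lt_top.ne).1 h'

/-- Two pairs of positive measures have the same difference. -/
instance diffSetoid : Setoid (PosRadon × PosRadon) where
  r x y := x.1 + y.2 = y.1 + x.2
  iseqv :=
    { refl := fun _ => rfl
      symm := fun h => h.symm
      trans := by
        intro x y z h1 h2
        apply add_right_cancel' (κ := y.2)
        calc x.1 + z.2 + y.2 = (x.1 + y.2) + z.2 := by ring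
          _ = (y.1 + z.2) + x.2 := by rw [h1]; ring
          _ = z.1 + x.2 + y.2 := by rw [h2]; ring }

end PosRadon

/-- `M₊(ℝ)`: the real Radon measures on `ℝ` with support bounded on the left. -/
def RadonPlus : Type := Quotient PosRadon.diffSetoid

namespace RadonPlus

/-- The real Radon measure `μ - ν`. -/
def diff (μ ν : PosRadon) : RadonPlus := Quotient.mk _ (μ, ν)

theorem diff_eq_iff {μ ν μ' ν' : PosRadon} : diff μ ν = diff μ' ν' ↔ μ + ν' = μ' + ν :=
  Quotient.eq

theorem ind {p : RadonPlus → Prop} (h : ∀ μ ν, p (diff μ ν)) (α : RadonPlus) : p α :=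
  Quotient.ind (fun x => h x.1 x.2) α

instance : Zero RadonPlus := ⟨diff 0 0⟩

/-- The unit is the Dirac measure at `0`. -/
noncomputable instance : One RadonPlus := ⟨diff 1 0⟩

instance : Neg RadonPlus := ⟨Quotient.lift (fun x => diff x.2 x.1) (by
  intro x y h
  change x.1 + y.2 = y.1 + x.2 at h
  rw [diff_eq_iff, add_comm, ← h, add_comm])⟩

instance : Add RadonPlus := ⟨Quotient.lift₂ (fun x y => diff (x.1 + y.1) (x.2 + y.2)) (by
  intro x y x' y' h k
  change x.1 + x'.2 = x'.1 + x.2 at h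
  change y.1 + y'.2 = y'.1 + y.2 at k
  rw [diff_eq_iff]
  calc x.1 + y.1 + (x'.2 + y'.2) = (x.1 + x'.2) + (y.1 + y'.2) := by ring
    _ = x'.1 + y'.1 + (x.2 + y.2) := by rw [h, k]; ring)⟩

/-- Convolution: `(μ - ν) * (μ' - ν') = (μ * μ' + ν * ν') - (μ * ν' + ν * μ')`. -/
noncomputable instance : Mul RadonPlus := ⟨Quotient.lift₂
  (fun x y => diff (x.1 * y.1 + x.2 * y.2) (x.1 * y.2 + x.2 * y.1)) (by
  intro x y x' y' h k
  change x.1 + x'.2 = x'.1 + x.2 at h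
  change y.1 + y'.2 = y'.1 + y.2 at k
  trans diff (x'.1 * y.1 + x'.2 * y.2) (x'.1 * y.2 + x'.2 * y.1)
  · rw [diff_eq_iff]
    calc _ = (x.1 + x'.2) * y.1 + (x'.1 + x.2) * y.2 := by ring
      _ = (x'.1 + x.2) * y.1 + (x.1 + x'.2) * y.2 := by rw [h]
      _ = _ := by ring
  · rw [diff_eq_iff]
    calc _ = x'.1 * (y.1 + y'.2) + x'.2 * (y'.1 + y.2) := by ring
      _ = x'.1 * (y'.1 + y.2) + x'.2 * (y.1 + y'.2) := by rw [k]
      _ = _ := by ring)⟩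

theorem zero_def : (0 : RadonPlus) = diff 0 0 := rfl
theorem one_def : (1 : RadonPlus) = diff 1 0 := rfl
theorem neg_diff (μ ν : PosRadon) : -diff μ ν = diff ν μ := rfl
theorem diff_add_diff (μ ν μ' ν' : PosRadon) :
    diff μ ν + diff μ' ν' = diff (μ + μ') (ν + ν') := rfl
theorem diff_mul_diff (μ ν μ' ν' : PosRadon) :
    diff μ ν * diff μ' ν' = diff (μ * μ' + ν * ν') (μ * ν' + ν * μ') := rfl

noncomputable instance : CommRing RadonPlus where
  nsmul := nsmulRec
  zsmul := zsmulRec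
  add_assoc α β γ := by
    induction α using ind; induction β using ind; induction γ using ind
    simp only [diff_add_diff, add_assoc]
  zero_add α := by
    induction α using ind
    simp only [zero_def, diff_add_diff, zero_add]
  add_zero α := by
    induction α using ind
    simp only [zero_def, diff_add_diff, add_zero]
  add_comm α β := by
    induction α using ind; induction β using ind
    simp only [diff_add_diff, add_comm]
  neg_add_cancel α := by
    induction α using ind
    rw [neg_diff, diff_add_diff, zero_def, diff_eq_iff]; ring
  left_distrib α β γ := by
    induction α using ind; induction β using ind; induction γ using ind
    simp only [diff_add_diff, diff_mul_diff, diff_eq_iff]; ring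
  right_distrib α β γ := by
    induction α using ind; induction β using ind; induction γ using ind
    simp only [diff_add_diff, diff_mul_diff, diff_eq_iff]; ring
  zero_mul α := by
    induction α using ind
    simp only [zero_def, diff_mul_diff, diff_eq_iff]; ring
  mul_zero α := by
    induction α using ind
    simp only [zero_def, diff_mul_diff, diff_eq_iff]; ring
  mul_assoc α β γ := by
    induction α using ind; induction β using ind; induction γ using ind
    simp only [diff_mul_diff, diff_eq_iff]; ring
  one_mul α := by
    induction α using ind
    simp only [one_def, diff_mul_diff, diff_eq_iff]; ring
  mul_one α := by
    induction α using ind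
    simp only [one_def, diff_mul_diff, diff_eq_iff]; ring
  mul_comm α β := by
    induction α using ind; induction β using ind
    simp only [diff_mul_diff, diff_eq_iff]; ring

/-! ### Real Radon measures as distributions; support; truncation -/

/-- The distribution `φ ↦ ∫ φ dμ` of a positive Radon measure `μ`. -/
noncomputable def posDistribution (μ : PosRadon) : 𝓓((⊤ : TopologicalSpace.Opens ℝ), ℝ) →L[ℝ] ℝ :=
  TestFunction.integralAgainstBilinCLM (ContinuousLinearMap.mul ℝ ℝ) μ.toMeasure (fun _ => 1)

theorem posDistribution_apply (μ : PosRadon) (φ : 𝓓((⊤ : TopologicalSpace.Opens ℝ), ℝ)) :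
    posDistribution μ φ = ∫ t, φ t ∂μ.toMeasure := by
  rw [posDistribution, TestFunction.integralAgainstBilinCLM_eq_integral]
  · simp
  · exact (locallyIntegrable_const 1).locallyIntegrableOn _

theorem posDistribution_add (μ ν : PosRadon) :
    posDistribution (μ + ν) = posDistribution μ + posDistribution ν := by
  ext φ
  have h : ∀ κ : PosRadon, Integrable (fun t => φ t) κ.toMeasure := fun κ =>
    φ.continuous.integrable_of_hasCompactSupport φ.hasCompactSupport
  simp only [posDistribution_apply, add_apply, PosRadon.toMeasure_add]
  exact integral_add_measure (h μ) (h ν)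

/-- The distribution `φ ↦ ∫ φ dμ - ∫ φ dν` of the real Radon measure `μ - ν`. -/
noncomputable def toDistribution (α : RadonPlus) :
    𝓓((⊤ : TopologicalSpace.Opens ℝ), ℝ) →L[ℝ] ℝ :=
  Quotient.lift (fun x : PosRadon × PosRadon => posDistribution x.1 - posDistribution x.2) (by
    intro x y h
    change x.1 + y.2 = y.1 + x.2 at h
    have h' := congrArg posDistribution h
    rw [posDistribution_add, posDistribution_add] at h'
    exact sub_eq_sub_iff_add_eq_add.2 h') α

/-- The support of a real Radon measure, as a distribution. -/
noncomputable def supp (α : RadonPlus) : Set ℝ := Distribution.dsupport α.toDistribution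

/-- `l(α)`, the infimum of the support of `α`.  (The support is bounded on the left; it is empty
only for `α = 0`, in which case the value is irrelevant.) -/
noncomputable def l (α : RadonPlus) : ℝ := sInf α.supp

/-- `M(ℝ₋)`: the real Radon measures with compact support contained in `(-∞, 0]`. -/
def MMinus : Set RadonPlus := {α | IsCompact α.supp ∧ α.supp ⊆ Iic 0}

/-- `𝓓(ℝ₊)`: the smooth functions on `ℝ` with compact support contained in `[0, ∞)`. -/
def testPlus : Submodule ℝ 𝓓((⊤ : TopologicalSpace.Opens ℝ), ℝ) where
  carrier := {φ | tsupport φ ⊆ Ici 0}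
  zero_mem' := by
    change tsupport (fun _ : ℝ => (0 : ℝ)) ⊆ Ici 0
    simp [tsupport, Function.support]
  add_mem' := by
    intro φ ψ hφ hψ
    exact (tsupport_add (f := φ) (g := ψ)).trans (union_subset hφ hψ)
  smul_mem' := by
    intro c φ hφ
    exact (closure_mono (Function.support_const_smul_subset c φ)).trans hφ

/-- The truncation `π(α)`: the restriction of the distribution `α` to `𝓓(ℝ₊)`. -/
noncomputable def trunc (α : RadonPlus) : testPlus →L[ℝ] ℝ :=
  α.toDistribution.comp testPlus.subtypeL

end RadonPlus

/-! ### Functions of class `L¹_loc` as Radon measures -/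

/-- Locally integrable functions on `ℝ` vanishing to the left of some point. -/
structure LocL1 where
  /-- the underlying function -/
  toFun : ℝ → ℝ
  locallyIntegrable : LocallyIntegrable toFun volume
  bddLeft : ∃ a : ℝ, ∀ t < a, toFun t = 0

namespace LocL1

/-- The positive measure `f⁺(t) dt`. -/
noncomputable def posMeasure (f : LocL1) : PosRadon where
  toMeasure := volume.withDensity (fun t => ENNReal.ofReal (f.toFun t))
  locallyFinite := by
    refine ⟨fun x => ?_⟩
    obtain ⟨s, hs, hfs⟩ := f.locallyIntegrable x
    obtain ⟨u, hus, hu, hxu⟩ := mem_nhds_iff.1 hs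
    refine ⟨u, hu.mem_nhds hxu, ?_⟩
    rw [withDensity_apply _ hu.measurableSet]
    exact lt_of_le_of_lt (lintegral_mono fun t => Real.ofReal_le_enorm _)
      (hfs.mono_set hus).hasFiniteIntegral
  bddLeft := by
    obtain ⟨a, ha⟩ := f.bddLeft
    refine ⟨a, ?_⟩
    rw [withDensity_apply _ measurableSet_Iio,
      setLIntegral_congr_fun measurableSet_Iio (g := fun _ => 0) fun t ht => by simp [ha t ht]]
    simp

/-- The function `-f`. -/
def neg (f : LocL1) : LocL1 where
  toFun := -f.toFun
  locallyIntegrable := f.locallyIntegrable.neg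
  bddLeft := f.bddLeft.imp fun _ h t ht => by simp [h t ht]

/-- The real Radon measure `f(t) dt = f⁺(t) dt - f⁻(t) dt`. -/
noncomputable def toRadon (f : LocL1) : RadonPlus := RadonPlus.diff f.posMeasure f.neg.posMeasure

/-- `Γ₁ = L¹_loc(ℝ₊)`, the functions being extended by zero to `ℝ`. -/
def Gamma : Set LocL1 := {f | ∀ t < 0, f.toFun t = 0}

/-- `L¹([-T, 0])`, the functions being extended by zero to `ℝ`: these are the elements of
`Ω₁ = ⋃ₙ L¹([-n, 0])` with support in `[-T, 0]`. -/
def OmegaIn (T : ℝ) : Set LocL1 := {f | ∀ t ∉ Icc (-T) 0, f.toFun t = 0}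

end LocL1

/-! ### Pseudo-rational systems of order zero -/

/-- A pseudo-rational system of order zero with `m` inputs and `d` outputs: matrices `Q` and `P`
over `M(ℝ₋)` such that `Q` has a convolution inverse over `M₊(ℝ)`.  Products of matrices over
`RadonPlus` are convolution products and `1` is `δ₀ I_d`. -/
structure PseudoRationalSystem (d m : ℕ) where
  Q : Matrix (Fin d) (Fin d) RadonPlus
  P : Matrix (Fin d) (Fin m) RadonPlus
  /-- the convolution inverse of `Q` -/
  Qinv : Matrix (Fin d) (Fin d) RadonPlus
  Q_mem : ∀ i j, Q i j ∈ RadonPlus.MMinus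
  P_mem : ∀ i j, P i j ∈ RadonPlus.MMinus
  Qinv_mul_Q : Qinv * Q = 1
  Q_mul_Qinv : Q * Qinv = 1

namespace PseudoRationalSystem

variable {d m : ℕ}

/-- The impulse response `A = Q⁻¹ * P`. -/
noncomputable def A (sys : PseudoRationalSystem d m) : Matrix (Fin d) (Fin m) RadonPlus :=
  sys.Qinv * sys.P

/-- The state space `X^{Q,1}`: all `y ∈ (Γ₁)^d` such that `π(Q * y) = 0`. -/
def stateSpace (sys : PseudoRationalSystem d m) : Set (Fin d → LocL1) :=
  {y | (∀ i, y i ∈ LocL1.Gamma) ∧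
    ∀ i, ((sys.Q.mulVec fun j => (y j).toRadon) i).trunc = 0}

/-- `X^{Q,1}`-reachability in time `T`: every `y ∈ X^{Q,1}` is the output `π(A * u)` of an input
`u ∈ (Ω₁)^m` with support in `[-T, 0]`. -/
def ReachableInTime (sys : PseudoRationalSystem d m) (T : ℝ) : Prop :=
  ∀ y ∈ sys.stateSpace, ∃ u : Fin m → LocL1, (∀ k, u k ∈ LocL1.OmegaIn T) ∧
    ∀ i, ((sys.A.mulVec fun k => (u k).toRadon) i).trunc = (y i).toRadon.trunc

/-- Left-coprimeness: `Q * R + P * S = δ₀ I_d` for some matrices `R`, `S` over `M(ℝ₋)`. -/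
def LeftCoprime (sys : PseudoRationalSystem d m) : Prop :=
  ∃ (R : Matrix (Fin d) (Fin d) RadonPlus) (S : Matrix (Fin m) (Fin d) RadonPlus),
    (∀ i j, R i j ∈ RadonPlus.MMinus) ∧ (∀ k j, S k j ∈ RadonPlus.MMinus) ∧
      sys.Q * R + sys.P * S = 1

end PseudoRationalSystem

/-! ### Measures determined by smooth test functions -/

/-! Let `concNonpos` be the subring of measures concentrated on (-∞, 0]. It equals M(ℝ₋), and π(α) =
0 exactly when α lies in it (`mem_MMinus_iff`, `trunc_eq_zero_iff`). The theorem thus becomes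
algebra modulo `concNonpos`, supplemented by bounds on supports and one compactness argument.

If Q*R + P*S = δ₀I and y is a state, then v = Q*y has entries in `concNonpos`, and A*(S*v) = y - R*v
has the same truncation as y. So the input S*v produces y; its support may only start too early.
With q = det Q, subtracting q*w from an input does not change the output, since q*A = adj(Q)*P has
entries in `concNonpos`. Taking for w the part of q⁻¹*(S*v) on (-∞, 0] leaves q times a measure on
(0, ∞), which starts no earlier than l(q) (`exists_input_concOn_Icc`).

Conversely, let S = (σ_j) be a matrix over M(ℝ₋) such that Q⁻¹ - A*S has entries in `concNonpos`.
Then R = Q⁻¹ - A*S gives Q*R + P*S = δ₀I. The column σ_j would be an input reproducing the response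
Q⁻¹*δ₀e_j, but reachability only reproduces the responses to L¹ data w. By the open mapping theorem
the inputs can be chosen with norm at most C‖w‖ (`exists_bounded_solution`). Letting w run through
an approximate identity, the inputs stay bounded in L¹([-T, 0]) and converge weakly, along an
ultrafilter, to the measures σ_j (`exists_weak_limit`). -/

theorem exists_testFunction_one_on_compact {K V : Set ℝ} (hK : IsCompact K) (hV : IsOpen V)
    (hKV : K ⊆ V) : ∃ φ : 𝓓((⊤ : TopologicalSpace.Opens ℝ), ℝ),
      (∀ x, φ x ∈ Icc (0 : ℝ) 1) ∧ (∀ x ∈ K, φ x = 1) ∧ tsupport φ ⊆ V := by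
  obtain ⟨W, hW, hKW, hWV, hWc⟩ := exists_open_between_and_isCompact_closure hK hV hKV
  obtain ⟨f, hf, hf01, hfs, hf1⟩ := exists_contMDiff_support_eq_eq_one_iff (n := ⊤)
    (modelWithCornersSelf ℝ ℝ) hW hK.isClosed hKW
  have ht : tsupport f ⊆ closure W := by rw [tsupport, hfs]
  exact ⟨⟨f, contMDiff_iff_contDiff.1 hf, hWc.of_isClosed_subset (isClosed_tsupport f) ht,
    subset_univ _⟩, fun x => hf01 (mem_range_self x), fun x hx => (hf1 x).1 hx, ht.trans hWV⟩

/-- Outer regularity gives an open V ⊇ K with ν V close to ν K; a smooth φ with 1_K ≤ φ ≤ 1_V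
supported in U ∩ V then compares the two measures. -/
theorem measure_le_of_forall_testFunction {μ ν : Measure ℝ} [IsLocallyFiniteMeasure μ]
    [IsLocallyFiniteMeasure ν] {U K : Set ℝ} (hU : IsOpen U) (hK : IsCompact K) (hKU : K ⊆ U)
    (h : ∀ φ : 𝓓((⊤ : TopologicalSpace.Opens ℝ), ℝ), tsupport φ ⊆ U →
      ∫ t, φ t ∂μ = ∫ t, φ t ∂ν) : μ K ≤ ν K := by
  refine le_of_forall_gt fun r hr => ?_
  obtain ⟨V, hKV, hV, hVr⟩ := K.exists_isOpen_lt_of_lt r hr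
  obtain ⟨φ, h01, h1, hs⟩ := exists_testFunction_one_on_compact hK (hU.inter hV)
    (subset_inter hKU hKV)
  have hi : ∀ (κ : Measure ℝ) [IsLocallyFiniteMeasure κ], Integrable (fun t => φ t) κ :=
    fun κ _ => φ.continuous.integrable_of_hasCompactSupport φ.hasCompactSupport
  have hl : ∀ (κ : Measure ℝ) [IsLocallyFiniteMeasure κ],
      ENNReal.ofReal (∫ t, φ t ∂κ) = ∫⁻ t, ENNReal.ofReal (φ t) ∂κ := fun κ _ =>
    ofReal_integral_eq_lintegral_ofReal (hi κ) (Filter.Eventually.of_forall fun t => (h01 t).1)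
  refine lt_of_le_of_lt ?_ hVr
  calc μ K = ∫⁻ t, K.indicator 1 t ∂μ := (lintegral_indicator_one hK.measurableSet).symm
    _ ≤ ∫⁻ t, ENNReal.ofReal (φ t) ∂μ := by
        refine lintegral_mono fun t => ?_
        by_cases ht : t ∈ K
        · simp [ht, h1 t ht]
        · simp [ht]
    _ = ∫⁻ t, ENNReal.ofReal (φ t) ∂ν := by
        rw [← hl, ← hl, h φ (hs.trans inter_subset_left)]
    _ ≤ ∫⁻ t, V.indicator 1 t ∂ν := by
        refine lintegral_mono fun t => ?_
        by_cases ht : t ∈ V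
        · simp only [ht, indicator_of_mem, Pi.one_apply]
          exact ENNReal.ofReal_le_one.2 (h01 t).2
        · have : φ t = 0 := by
            by_contra hne
            exact ht (hs (subset_tsupport _ hne)).2
          simp [this]
    _ = ν V := lintegral_indicator_one hV.measurableSet

theorem restrict_eq_of_forall_testFunction {μ ν : Measure ℝ} [IsLocallyFiniteMeasure μ]
    [IsLocallyFiniteMeasure ν] {U : Set ℝ} (hU : IsOpen U)
    (h : ∀ φ : 𝓓((⊤ : TopologicalSpace.Opens ℝ), ℝ), tsupport φ ⊆ U →
      ∫ t, φ t ∂μ = ∫ t, φ t ∂ν) : μ.restrict U = ν.restrict U := by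
  ext s hs
  rw [Measure.restrict_apply hs, Measure.restrict_apply hs,
    (hs.inter hU.measurableSet).measure_eq_iSup_isCompact,
    (hs.inter hU.measurableSet).measure_eq_iSup_isCompact]
  refine iSup_congr fun K => iSup_congr fun hKs => iSup_congr fun hK => ?_
  have hKU := hKs.trans inter_subset_right
  exact le_antisymm (measure_le_of_forall_testFunction hU hK hKU h)
    (measure_le_of_forall_testFunction hU hK hKU fun φ hφ => (h φ hφ).symm)

/-! ### Restriction of real Radon measures to a set -/

theorem PosRadon.restrict_eq_self {μ : PosRadon} {s : Set ℝ} (hs : μ.toMeasure sᶜ = 0) :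
    μ.toMeasure.restrict s = μ.toMeasure :=
  Measure.restrict_eq_self_of_ae_mem (measure_eq_zero_iff_ae_notMem.1 hs |>.mono fun x hx => by
    simpa using hx)

/-- The restriction of a positive Radon measure to a set. -/
noncomputable def PosRadon.restr (s : Set ℝ) (μ : PosRadon) : PosRadon where
  toMeasure := μ.toMeasure.restrict s
  locallyFinite := inferInstance
  bddLeft := μ.bddLeft.imp fun _ h => le_antisymm ((Measure.restrict_apply_le _ _).trans h.le)
    zero_le

theorem PosRadon.restr_add (s : Set ℝ) (μ ν : PosRadon) :
    (μ + ν).restr s = μ.restr s + ν.restr s :=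
  PosRadon.ext (Measure.restrict_add _ _ _)

namespace RadonPlus

/-- The restriction of a real Radon measure to a set. -/
noncomputable def restr (s : Set ℝ) : RadonPlus → RadonPlus :=
  Quotient.map (fun x => (x.1.restr s, x.2.restr s)) (by
    intro x y h
    change x.1 + y.2 = y.1 + x.2 at h
    change x.1.restr s + y.2.restr s = y.1.restr s + x.2.restr s
    rw [← PosRadon.restr_add, h, PosRadon.restr_add])

theorem restr_diff (s : Set ℝ) (μ ν : PosRadon) :
    restr s (diff μ ν) = diff (μ.restr s) (ν.restr s) := rfl

theorem restr_add (s : Set ℝ) (α β : RadonPlus) : restr s (α + β) = restr s α + restr s β := by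
  induction α using ind; induction β using ind
  simp only [diff_add_diff, restr_diff, PosRadon.restr_add]

theorem restr_neg (s : Set ℝ) (α : RadonPlus) : restr s (-α) = -restr s α := by
  induction α using ind
  simp only [neg_diff, restr_diff]

theorem restr_zero (s : Set ℝ) : restr s 0 = 0 := by
  simpa using restr_add s 0 0

theorem restr_restr {s : Set ℝ} (t : Set ℝ) (hs : MeasurableSet s) (α : RadonPlus) :
    restr s (restr t α) = restr (s ∩ t) α := by
  induction α using ind
  simp only [restr_diff]
  congr 1 <;> exact PosRadon.ext (Measure.restrict_restrict hs)

theorem restr_add_restr_compl {s : Set ℝ} (hs : MeasurableSet s) (α : RadonPlus) :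
    restr s α + restr sᶜ α = α := by
  induction α using ind
  simp only [restr_diff, diff_add_diff]
  congr 1 <;> exact PosRadon.ext (Measure.restrict_add_restrict_compl hs)

/-- `α` is concentrated on `s`. -/
def ConcOn (s : Set ℝ) (α : RadonPlus) : Prop := restr s α = α

theorem concOn_diff {s : Set ℝ} {μ ν : PosRadon} (hμ : μ.toMeasure sᶜ = 0)
    (hν : ν.toMeasure sᶜ = 0) : ConcOn s (diff μ ν) := by
  rw [ConcOn, restr_diff]
  congr 1 <;> exact PosRadon.ext (PosRadon.restrict_eq_self ‹_›)

theorem ConcOn.exists_diff {s : Set ℝ} {α : RadonPlus} (hs : MeasurableSet s) (h : ConcOn s α) :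
    ∃ μ ν, α = diff μ ν ∧ μ.toMeasure sᶜ = 0 ∧ ν.toMeasure sᶜ = 0 := by
  induction α using ind with
  | h μ ν =>
    refine ⟨μ.restr s, ν.restr s, h.symm, ?_, ?_⟩ <;>
    · change (Measure.restrict _ s) sᶜ = 0
      rw [Measure.restrict_apply hs.compl]
      simp

theorem ConcOn.add {s : Set ℝ} {α β : RadonPlus} (h : ConcOn s α) (k : ConcOn s β) :
    ConcOn s (α + β) := by
  rw [ConcOn, restr_add, h, k]

theorem ConcOn.neg {s : Set ℝ} {α : RadonPlus} (h : ConcOn s α) : ConcOn s (-α) := by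
  rw [ConcOn, restr_neg, h]

theorem concOn_zero (s : Set ℝ) : ConcOn s 0 := restr_zero s

theorem concOn_restr {s : Set ℝ} (hs : MeasurableSet s) (α : RadonPlus) :
    ConcOn s (restr s α) := by
  rw [ConcOn, restr_restr _ hs, inter_self]

theorem ConcOn.inter {s t : Set ℝ} {α : RadonPlus} (hs : MeasurableSet s) (h : ConcOn s α)
    (k : ConcOn t α) : ConcOn (s ∩ t) α := by
  rw [ConcOn, ← restr_restr _ hs, k, h]

theorem ConcOn.mono {s t : Set ℝ} {α : RadonPlus} (hs : MeasurableSet s) (h : ConcOn s α)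
    (hst : s ⊆ t) : ConcOn t α := by
  obtain ⟨μ, ν, rfl, h1, h2⟩ := h.exists_diff hs
  exact concOn_diff (measure_mono_null (compl_subset_compl.2 hst) h1)
    (measure_mono_null (compl_subset_compl.2 hst) h2)

theorem concOn_iff_restr_compl {s : Set ℝ} {α : RadonPlus} (hs : MeasurableSet s) :
    ConcOn s α ↔ restr sᶜ α = 0 := by
  have := restr_add_restr_compl hs α
  constructor
  · intro h
    rw [show restr s α = α from h] at this
    exact left_eq_add.1 this.symm
  · intro h
    rwa [h, add_zero] at this

/-! ### Half-lines and convolution -/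

theorem exists_concOn_Ici (α : RadonPlus) : ∃ a : ℝ, ConcOn (Ici a) α := by
  induction α using ind with
  | h μ ν =>
    obtain ⟨a, ha⟩ := μ.bddLeft
    obtain ⟨b, hb⟩ := ν.bddLeft
    refine ⟨min a b, concOn_diff ?_ ?_⟩ <;> rw [compl_Ici]
    · exact measure_mono_null (Iio_subset_Iio (min_le_left a b)) ha
    · exact measure_mono_null (Iio_subset_Iio (min_le_right a b)) hb

theorem ConcOn.mul_Ici {a b : ℝ} {α β : RadonPlus} (h : ConcOn (Ici a) α)
    (k : ConcOn (Ici b) β) : ConcOn (Ici (a + b)) (α * β) := by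
  obtain ⟨μ, ν, rfl, h1, h2⟩ := h.exists_diff measurableSet_Ici
  obtain ⟨μ', ν', rfl, h1', h2'⟩ := k.exists_diff measurableSet_Ici
  rw [compl_Ici] at *
  rw [diff_mul_diff]
  apply concOn_diff <;> rw [compl_Ici]
  · simp [PosRadon.conv_bddLeft h1 h1', PosRadon.conv_bddLeft h2 h2']
  · simp [PosRadon.conv_bddLeft h1 h2', PosRadon.conv_bddLeft h2 h1']

theorem conv_Ioi_eq_zero {μ ν : Measure ℝ} [SFinite μ] [SFinite ν] {a b : ℝ}
    (ha : μ (Ioi a) = 0) (hb : ν (Ioi b) = 0) : (μ.conv ν) (Ioi (a + b)) = 0 := by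
  rw [Measure.conv, Measure.map_apply (by fun_prop) measurableSet_Ioi]
  refine measure_mono_null (t := (Ioi a ×ˢ univ) ∪ (univ ×ˢ Ioi b)) ?_ ?_
  · rintro ⟨x, y⟩ h
    simp only [mem_preimage, mem_Ioi] at h
    simp only [mem_union, mem_prod, mem_Ioi, mem_univ, and_true, true_and]
    by_contra! hc
    linarith
  · rw [measure_union_null_iff, Measure.prod_prod, Measure.prod_prod, ha, hb]
    simp

theorem ConcOn.mul_Iic {a b : ℝ} {α β : RadonPlus} (h : ConcOn (Iic a) α)
    (k : ConcOn (Iic b) β) : ConcOn (Iic (a + b)) (α * β) := by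
  obtain ⟨μ, ν, rfl, h1, h2⟩ := h.exists_diff measurableSet_Iic
  obtain ⟨μ', ν', rfl, h1', h2'⟩ := k.exists_diff measurableSet_Iic
  rw [compl_Iic] at *
  rw [diff_mul_diff]
  apply concOn_diff <;> rw [compl_Iic]
  · simp [conv_Ioi_eq_zero h1 h1', conv_Ioi_eq_zero h2 h2']
  · simp [conv_Ioi_eq_zero h1 h2', conv_Ioi_eq_zero h2 h1']

/-- The subring of real Radon measures concentrated on `(-∞, 0]`. -/
def concNonpos : Subring RadonPlus where
  carrier := {α | ConcOn (Iic 0) α}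
  zero_mem' := concOn_zero _
  one_mem' := by
    apply concOn_diff <;> simp
  add_mem' := ConcOn.add
  neg_mem' := ConcOn.neg
  mul_mem' h k := by simpa using ConcOn.mul_Iic h k

theorem mem_concNonpos {α : RadonPlus} : α ∈ concNonpos ↔ ConcOn (Iic 0) α := Iff.rfl

/-! ### Restriction and the associated distribution -/

theorem toDistribution_diff (μ ν : PosRadon) (φ : 𝓓((⊤ : TopologicalSpace.Opens ℝ), ℝ)) :
    (diff μ ν).toDistribution φ = ∫ t, φ t ∂μ.toMeasure - ∫ t, φ t ∂ν.toMeasure := by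
  rw [← posDistribution_apply, ← posDistribution_apply]; rfl

theorem toDistribution_add (α β : RadonPlus) (φ : 𝓓((⊤ : TopologicalSpace.Opens ℝ), ℝ)) :
    (α + β).toDistribution φ = α.toDistribution φ + β.toDistribution φ := by
  induction α using ind; induction β using ind
  rw [diff_add_diff, toDistribution_diff, toDistribution_diff, toDistribution_diff]
  simp only [← posDistribution_apply, posDistribution_add]
  simp only [add_apply]
  ring

theorem toDistribution_neg (α : RadonPlus) (φ : 𝓓((⊤ : TopologicalSpace.Opens ℝ), ℝ)) :
    (-α).toDistribution φ = -α.toDistribution φ := by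
  induction α using ind
  rw [neg_diff, toDistribution_diff, toDistribution_diff]
  ring

theorem toDistribution_sub (α β : RadonPlus) (φ : 𝓓((⊤ : TopologicalSpace.Opens ℝ), ℝ)) :
    (α - β).toDistribution φ = α.toDistribution φ - β.toDistribution φ := by
  rw [sub_eq_add_neg, toDistribution_add, toDistribution_neg, sub_eq_add_neg]

theorem toDistribution_sum {ι : Type*} (s : Finset ι) (α : ι → RadonPlus)
    (φ : 𝓓((⊤ : TopologicalSpace.Opens ℝ), ℝ)) :
    (∑ i ∈ s, α i).toDistribution φ = ∑ i ∈ s, (α i).toDistribution φ :=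
  map_sum (AddMonoidHom.mk' (fun α : RadonPlus => α.toDistribution φ)
    fun α β => toDistribution_add α β φ) α s

theorem restr_diff_eq_zero_iff {s : Set ℝ} {μ ν : PosRadon} :
    restr s (diff μ ν) = 0 ↔ μ.toMeasure.restrict s = ν.toMeasure.restrict s := by
  rw [restr_diff, zero_def, diff_eq_iff, add_zero, zero_add, PosRadon.ext_iff]
  rfl

theorem restr_eq_zero_of_vanishing {U : Set ℝ} (hU : IsOpen U) {α : RadonPlus}
    (h : Distribution.IsVanishingOn α.toDistribution U) : restr U α = 0 := by
  induction α using ind with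
  | h μ ν =>
    rw [restr_diff_eq_zero_iff]
    refine restrict_eq_of_forall_testFunction hU fun φ hφ => ?_
    have := h φ hφ
    rwa [toDistribution_diff, sub_eq_zero] at this

/-- Since α is a measure, it is enough that φ vanishes on s itself; no neighbourhood of s is needed.
-/
theorem ConcOn.toDistribution_eq_zero {s : Set ℝ} (hs : MeasurableSet s) {α : RadonPlus}
    (h : ConcOn s α) {φ : 𝓓((⊤ : TopologicalSpace.Opens ℝ), ℝ)} (hφ : ∀ t ∈ s, φ t = 0) :
    α.toDistribution φ = 0 := by
  obtain ⟨μ, ν, rfl, h1, h2⟩ := h.exists_diff hs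
  have key : ∀ κ : Measure ℝ, κ sᶜ = 0 → ∫ t, φ t ∂κ = 0 := by
    intro κ hκ
    refine integral_eq_zero_of_ae ((measure_eq_zero_iff_ae_notMem.1 hκ).mono fun t ht => ?_)
    exact hφ t (by simpa using ht)
  rw [toDistribution_diff, key _ h1, key _ h2, sub_zero]

/-! ### Support, `l` and truncation in terms of concentration -/

theorem isClosed_supp (α : RadonPlus) : IsClosed α.supp := Distribution.isClosed_dsupport

/-- The complement of the support is a union of open sets on which α vanishes; by the Lindelöf
property countably many suffice, and equality of measures passes to countable unions. -/
theorem concOn_supp (α : RadonPlus) : ConcOn α.supp α := by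
  rw [concOn_iff_restr_compl α.isClosed_supp.measurableSet, supp, Distribution.dsupport_compl_eq]
  obtain ⟨T, hT, hTS, hTU⟩ := TopologicalSpace.isOpen_sUnion_countable
    {a | Distribution.IsVanishingOn α.toDistribution a ∧ IsOpen a} fun s hs => hs.2
  rw [← hTU]
  have h : ∀ s ∈ T, restr s α = 0 := fun s hs =>
    restr_eq_zero_of_vanishing (hTS hs).2 (hTS hs).1
  clear hTU hTS
  induction α using ind with
  | h μ ν =>
    rw [restr_diff_eq_zero_iff, Measure.restrict_sUnion_congr hT]
    exact fun s hs => restr_diff_eq_zero_iff.1 (h s hs)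

theorem ConcOn.supp_subset {s : Set ℝ} (hs : IsClosed s) {α : RadonPlus} (h : ConcOn s α) :
    α.supp ⊆ s := by
  refine sInter_subset_of_mem ⟨fun φ hφ => ?_, hs⟩
  refine h.toDistribution_eq_zero hs.measurableSet fun t ht => ?_
  by_contra hne
  exact hφ (subset_tsupport _ hne) ht

/-- Compactness of the support is automatic, because it is already bounded on the left. -/
theorem mem_MMinus_iff {α : RadonPlus} : α ∈ MMinus ↔ α ∈ concNonpos := by
  refine ⟨fun h => α.concOn_supp.mono α.isClosed_supp.measurableSet h.2, fun h => ⟨?_, ?_⟩⟩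
  · obtain ⟨a, ha⟩ := α.exists_concOn_Ici
    exact isCompact_Icc.of_isClosed_subset α.isClosed_supp
      ((ha.inter measurableSet_Ici h).supp_subset isClosed_Icc)
  · exact ConcOn.supp_subset isClosed_Iic h

theorem concOn_Ici_l (α : RadonPlus) : ConcOn (Ici α.l) α := by
  obtain ⟨a, ha⟩ := α.exists_concOn_Ici
  refine α.concOn_supp.mono α.isClosed_supp.measurableSet fun x hx => csInf_le ⟨a, ?_⟩ hx
  exact fun y hy => ha.supp_subset isClosed_Ici hy

theorem eq_zero_of_mem_testPlus {φ : 𝓓((⊤ : TopologicalSpace.Opens ℝ), ℝ)} (hφ : φ ∈ testPlus)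
    {t : ℝ} (ht : t ≤ 0) : φ t = 0 := by
  have h : EqOn φ (fun _ => (0 : ℝ)) (Iio 0) := fun s hs => by
    by_contra hne
    exact (mem_Iio.1 hs).not_ge (mem_Ici.1 (hφ (subset_tsupport _ hne)))
  exact (h.closure φ.continuous continuous_const) (by rwa [closure_Iio])

/-- Test functions supported in (0, ∞) already detect α there, while every member of `testPlus`
vanishes at 0 by continuity, so an atom at 0 is invisible. -/
theorem trunc_eq_zero_iff {α : RadonPlus} :
    α.trunc = 0 ↔ α ∈ concNonpos := by
  constructor
  · intro h
    rw [mem_concNonpos, concOn_iff_restr_compl measurableSet_Iic, compl_Iic]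
    refine restr_eq_zero_of_vanishing isOpen_Ioi fun φ hφ => ?_
    exact congrArg (fun f : testPlus →L[ℝ] ℝ => f ⟨φ, hφ.trans Ioi_subset_Ici_self⟩) h
  · intro h
    ext φ
    exact ConcOn.toDistribution_eq_zero measurableSet_Iic h
      fun t ht => eq_zero_of_mem_testPlus φ.2 ht

theorem trunc_sub (α β : RadonPlus) : (α - β).trunc = α.trunc - β.trunc := by
  ext φ
  exact toDistribution_sub α β φ

theorem trunc_eq_trunc_iff {α β : RadonPlus} :
    α.trunc = β.trunc ↔ α - β ∈ concNonpos := by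
  rw [← trunc_eq_zero_iff, trunc_sub, sub_eq_zero]

end RadonPlus

/-! ### Absolutely continuous real Radon measures -/

theorem PosRadon.exists_density {μ : PosRadon} (h : μ.toMeasure ≪ volume) {s : Set ℝ}
    (hs : MeasurableSet s) (h0 : μ.toMeasure sᶜ = 0) :
    ∃ p : ℝ → ℝ, Measurable p ∧ (∀ t, 0 ≤ p t) ∧ (∀ t ∉ s, p t = 0) ∧
      LocallyIntegrable p volume ∧
      μ.toMeasure = volume.withDensity (fun t => ENNReal.ofReal (p t)) := by
  -- The indicator makes the density vanish everywhere off s, not just almost everywhere, as `Gamma`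
  -- and `OmegaIn` demand.
  have hm : Measurable (s.indicator (μ.toMeasure.rnDeriv volume)) :=
    (Measure.measurable_rnDeriv _ _).indicator hs
  have hd : volume.withDensity (s.indicator (μ.toMeasure.rnDeriv volume)) = μ.toMeasure := by
    rw [withDensity_indicator hs, ← restrict_withDensity hs, Measure.withDensity_rnDeriv_eq _ _ h,
      PosRadon.restrict_eq_self h0]
  refine ⟨fun t => (s.indicator (μ.toMeasure.rnDeriv volume) t).toReal, hm.ennreal_toReal,
    fun t => ENNReal.toReal_nonneg, fun t ht => by simp [ht], ?_, ?_⟩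
  · rw [locallyIntegrable_iff]
    intro K hK
    refine integrable_toReal_of_lintegral_ne_top hm.aemeasurable ?_
    rw [← withDensity_apply _ hK.measurableSet, hd]
    exact hK.measure_lt_top.ne
  · nth_rewrite 1 [← hd]
    refine withDensity_congr_ae ?_
    filter_upwards [Measure.rnDeriv_lt_top μ.toMeasure volume] with t ht
    rw [ENNReal.ofReal_toReal]
    exact ne_of_lt (lt_of_le_of_lt (indicator_le_self _ _ _) ht)

namespace RadonPlus

/-- `α` is absolutely continuous with respect to Lebesgue measure. -/
def AbsCont (α : RadonPlus) : Prop :=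
  ∃ μ ν, α = diff μ ν ∧ μ.toMeasure ≪ volume ∧ ν.toMeasure ≪ volume

theorem absCont_zero : AbsCont 0 :=
  ⟨0, 0, rfl, Measure.AbsolutelyContinuous.zero _, Measure.AbsolutelyContinuous.zero _⟩

theorem AbsCont.add {α β : RadonPlus} (h : AbsCont α) (k : AbsCont β) : AbsCont (α + β) := by
  obtain ⟨μ, ν, rfl, h1, h2⟩ := h
  obtain ⟨μ', ν', rfl, h1', h2'⟩ := k
  exact ⟨μ + μ', ν + ν', rfl, h1.add_left h1', h2.add_left h2'⟩

theorem AbsCont.neg {α : RadonPlus} (h : AbsCont α) : AbsCont (-α) := by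
  obtain ⟨μ, ν, rfl, h1, h2⟩ := h
  exact ⟨ν, μ, rfl, h2, h1⟩

theorem AbsCont.sub {α β : RadonPlus} (h : AbsCont α) (k : AbsCont β) : AbsCont (α - β) := by
  rw [sub_eq_add_neg]
  exact h.add k.neg

theorem AbsCont.sum {ι : Type*} {s : Finset ι} {α : ι → RadonPlus}
    (h : ∀ i ∈ s, AbsCont (α i)) : AbsCont (∑ i ∈ s, α i) :=
  Finset.sum_induction _ AbsCont (fun _ _ => AbsCont.add) absCont_zero h

theorem AbsCont.mul_left {β : RadonPlus} (α : RadonPlus) (h : AbsCont β) : AbsCont (α * β) := by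
  induction α using ind with
  | h μ' ν' =>
    obtain ⟨μ, ν, rfl, h1, h2⟩ := h
    exact ⟨_, _, rfl,
      (Measure.conv_absolutelyContinuous h1).add_left (Measure.conv_absolutelyContinuous h2),
      (Measure.conv_absolutelyContinuous h2).add_left (Measure.conv_absolutelyContinuous h1)⟩

theorem AbsCont.restr {α : RadonPlus} (s : Set ℝ) (h : AbsCont α) : AbsCont (restr s α) := by
  obtain ⟨μ, ν, rfl, h1, h2⟩ := h
  exact ⟨_, _, rfl, Measure.restrict_le_self.absolutelyContinuous.trans h1,
    Measure.restrict_le_self.absolutelyContinuous.trans h2⟩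

theorem AbsCont.mulVec {m n : Type*} [Fintype n] (M : Matrix m n RadonPlus) {v : n → RadonPlus}
    (h : ∀ j, AbsCont (v j)) (i : m) : AbsCont (M.mulVec v i) :=
  AbsCont.sum fun j _ => (h j).mul_left _

theorem absCont_toRadon (f : LocL1) : AbsCont f.toRadon :=
  ⟨_, _, rfl, withDensity_absolutelyContinuous _ _, withDensity_absolutelyContinuous _ _⟩

theorem concOn_toRadon {f : LocL1} {s : Set ℝ} (hs : MeasurableSet s)
    (h : ∀ t ∉ s, f.toFun t = 0) : ConcOn s f.toRadon := by
  have key : ∀ g : LocL1, (∀ t ∉ s, g.toFun t = 0) → g.posMeasure.toMeasure sᶜ = 0 := by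
    intro g hg
    change (volume.withDensity _) sᶜ = 0
    rw [withDensity_apply _ hs.compl, setLIntegral_congr_fun hs.compl (g := fun _ => 0)
      fun t ht => by simp [hg t ht]]
    simp
  exact concOn_diff (key f h) (key f.neg fun t ht => by
    change -f.toFun t = 0
    rw [h t ht, neg_zero])

theorem AbsCont.exists_locL1 {α : RadonPlus} (h : AbsCont α) {s : Set ℝ} (hs : MeasurableSet s)
    {a : ℝ} (hsa : s ⊆ Ici a) (hα : ConcOn s α) :
    ∃ f : LocL1, f.toRadon = α ∧ ∀ t ∉ s, f.toFun t = 0 := by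
  obtain ⟨μ, ν, rfl, h1, h2⟩ := h
  have h0 : ∀ κ : PosRadon, (κ.restr s).toMeasure sᶜ = 0 := by
    intro κ
    change (κ.toMeasure.restrict s) sᶜ = 0
    rw [Measure.restrict_apply hs.compl]
    simp
  obtain ⟨p, hpm, hp0, hps, hpi, hp⟩ := PosRadon.exists_density (μ := μ.restr s)
    (Measure.restrict_le_self.absolutelyContinuous.trans h1) hs (h0 μ)
  obtain ⟨q, hqm, hq0, hqs, hqi, hq⟩ := PosRadon.exists_density (μ := ν.restr s)
    (Measure.restrict_le_self.absolutelyContinuous.trans h2) hs (h0 ν)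
  have hz : ∀ t ∉ s, (p - q) t = 0 := fun t ht => by simp [hps t ht, hqs t ht]
  refine ⟨⟨p - q, hpi.sub hqi, a, fun t ht => hz t fun hts => ?_⟩, ?_, hz⟩
  · exact not_lt.2 (mem_Ici.1 (hsa hts)) ht
  · rw [← show RadonPlus.restr s (diff μ ν) = diff μ ν from hα, restr_diff, LocL1.toRadon,
      diff_eq_iff]
    refine PosRadon.ext ?_
    rw [PosRadon.toMeasure_add, PosRadon.toMeasure_add, hp, hq]
    change volume.withDensity _ + _ = _ + volume.withDensity _
    rw [← withDensity_add_right _ (by fun_prop), ← withDensity_add_left (by fun_prop)]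
    congr 1
    ext t
    simp only [Pi.add_apply, LocL1.neg, Pi.sub_apply, neg_sub]
    -- Both sides equal max (p t) (q t).
    rcases le_total (p t) (q t) with hle | hle
    · rw [ENNReal.ofReal_of_nonpos (sub_nonpos.2 hle), zero_add,
        ← ENNReal.ofReal_add (hp0 t) (sub_nonneg.2 hle), add_sub_cancel]
    · rw [ENNReal.ofReal_of_nonpos (p := q t - p t) (sub_nonpos.2 hle), add_zero,
        ← ENNReal.ofReal_add (sub_nonneg.2 hle) (hq0 t), sub_add_cancel]

end RadonPlus

/-! ### Matrices with entries in a subring -/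

theorem Subring.det_mem {R n : Type*} [CommRing R] [Fintype n] [DecidableEq n] (S : Subring R)
    {M : Matrix n n R} (h : ∀ i j, M i j ∈ S) : M.det ∈ S := by
  have hM : M = S.subtype.mapMatrix (Matrix.of fun i j => (⟨M i j, h i j⟩ : S)) := rfl
  rw [hM, ← RingHom.map_det]
  exact SetLike.coe_mem _

theorem Subring.adjugate_mem {R n : Type*} [CommRing R] [Fintype n] [DecidableEq n] (S : Subring R)
    {M : Matrix n n R} (h : ∀ i j, M i j ∈ S) (i j : n) : M.adjugate i j ∈ S := by
  have hM : M = S.subtype.mapMatrix (Matrix.of fun i j => (⟨M i j, h i j⟩ : S)) := rfl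
  rw [hM, ← RingHom.map_adjugate]
  exact SetLike.coe_mem _

theorem Subring.mulVec_mem {R m n : Type*} [CommRing R] [Fintype n] (S : Subring R)
    {M : Matrix m n R} {v : n → R} (h : ∀ i j, M i j ∈ S) (hv : ∀ j, v j ∈ S) (i : m) :
    M.mulVec v i ∈ S :=
  S.sum_mem fun j _ => S.mul_mem (h i j) (hv j)

/-! ### Left-coprime systems are reachable -/

namespace PseudoRationalSystem

open RadonPlus

variable {d m : ℕ}

theorem Q_mem_concNonpos (sys : PseudoRationalSystem d m) (i j : Fin d) :
    sys.Q i j ∈ concNonpos := mem_MMinus_iff.1 (sys.Q_mem i j)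

theorem P_mem_concNonpos (sys : PseudoRationalSystem d m) (i : Fin d) (k : Fin m) :
    sys.P i k ∈ concNonpos := mem_MMinus_iff.1 (sys.P_mem i k)

theorem det_Q_mul_det_Qinv (sys : PseudoRationalSystem d m) : sys.Q.det * sys.Qinv.det = 1 := by
  rw [← Matrix.det_mul, sys.Q_mul_Qinv, Matrix.det_one]

theorem adjugate_Q (sys : PseudoRationalSystem d m) :
    sys.Q.adjugate = sys.Q.det • sys.Qinv := by
  calc sys.Q.adjugate = sys.Q.adjugate * (sys.Q * sys.Qinv) := by rw [sys.Q_mul_Qinv, mul_one]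
    _ = sys.Q.det • sys.Qinv := by
      rw [← mul_assoc, Matrix.adjugate_mul, smul_mul_assoc, one_mul]

theorem stateSpace_mem_iff (sys : PseudoRationalSystem d m) (y : Fin d → LocL1) :
    y ∈ sys.stateSpace ↔ (∀ i, y i ∈ LocL1.Gamma) ∧
      ∀ i, (sys.Q.mulVec fun j => (y j).toRadon) i ∈ concNonpos := by
  simp only [stateSpace, mem_ofPred_eq, trunc_eq_zero_iff]

/-- Subtracting a multiple of `det Q` from an absolutely continuous input supported in `(-∞, 0]`
moves its support into `[l(det Q), 0]` without changing the output. -/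
theorem exists_input_concOn_Icc (sys : PseudoRationalSystem d m) {u : Fin m → RadonPlus}
    (hu : ∀ k, u k ∈ concNonpos) (hac : ∀ k, AbsCont (u k)) :
    ∃ u' : Fin m → RadonPlus, (∀ k, ConcOn (Icc (l sys.Q.det) 0) (u' k)) ∧
      (∀ k, AbsCont (u' k)) ∧ ∀ i, sys.A.mulVec u i - sys.A.mulVec u' i ∈ concNonpos := by
  set q := sys.Q.det
  have hq : q ∈ concNonpos := concNonpos.det_mem sys.Q_mem_concNonpos
  -- `det Qinv` is the inverse of q, so w is the part of u/q on (-∞, 0].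
  let w : Fin m → RadonPlus := fun k => restr (Iic 0) (sys.Qinv.det * u k)
  have hw : ∀ k, w k ∈ concNonpos := fun k => concOn_restr measurableSet_Iic _
  have hrem : ∀ k, u k - q * w k = q * restr (Ioi 0) (sys.Qinv.det * u k) := by
    intro k
    have h := restr_add_restr_compl (measurableSet_Iic (a := (0 : ℝ))) (sys.Qinv.det * u k)
    rw [compl_Iic] at h
    calc u k - q * w k = q * (sys.Qinv.det * u k) - q * w k := by
          rw [← mul_assoc, sys.det_Q_mul_det_Qinv, one_mul]
      _ = _ := by
          rw [← mul_sub]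
          congr 1
          exact sub_eq_of_eq_add' h.symm
  refine ⟨fun k => u k - q * w k, fun k => ?_, fun k => ?_, fun i => ?_⟩
  · have h1 : ConcOn (Ici (l q)) (u k - q * w k) := by
      rw [hrem]
      have := (concOn_Ici_l q).mul_Ici ((concOn_restr measurableSet_Ioi
        (sys.Qinv.det * u k)).mono measurableSet_Ioi (Ioi_subset_Ici_self (a := (0 : ℝ))))
      rwa [add_zero] at this
    exact h1.inter measurableSet_Ici (concNonpos.sub_mem (hu k) (concNonpos.mul_mem hq (hw k)))
  · exact (hac k).sub ((((hac k).mul_left _).restr _).mul_left _)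
  · have h : sys.A.mulVec u - sys.A.mulVec (fun k => u k - q * w k) =
        sys.Q.adjugate.mulVec (sys.P.mulVec w) := by
      rw [← Matrix.mulVec_sub, sys.adjugate_Q, Matrix.smul_mulVec, Matrix.mulVec_mulVec,
        ← PseudoRationalSystem.A, ← Matrix.mulVec_smul]
      congr 1
      ext k
      simp [q]
    have h' := congrFun h i
    rw [Pi.sub_apply] at h'
    rw [h']
    exact concNonpos.mulVec_mem (concNonpos.adjugate_mem sys.Q_mem_concNonpos)
      (concNonpos.mulVec_mem sys.P_mem_concNonpos hw) i

theorem LeftCoprime.reachableInTime {sys : PseudoRationalSystem d m} (h : sys.LeftCoprime)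
    {T : ℝ} (hT : -(l sys.Q.det) ≤ T) : sys.ReachableInTime T := by
  obtain ⟨R, S, hR, hS, hRS⟩ := h
  simp only [mem_MMinus_iff] at hR hS
  intro y hy
  rw [stateSpace_mem_iff] at hy
  set Y : Fin d → RadonPlus := fun j => (y j).toRadon
  set v := sys.Q.mulVec Y
  have hvac : ∀ i, AbsCont (v i) := AbsCont.mulVec _ fun j => absCont_toRadon _
  obtain ⟨u, huc, hua, hu⟩ := sys.exists_input_concOn_Icc
    (concNonpos.mulVec_mem hS hy.2) (AbsCont.mulVec S hvac)
  have hf : ∀ k, ∃ f : LocL1, f.toRadon = u k ∧ ∀ t ∉ Icc (-T) 0, f.toFun t = 0 := fun k =>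
    (hua k).exists_locL1 measurableSet_Icc Icc_subset_Ici_self
      ((huc k).mono measurableSet_Icc (Icc_subset_Icc_left (by linarith)))
  choose f hfu hfT using hf
  refine ⟨f, hfT, fun i => ?_⟩
  rw [trunc_eq_trunc_iff]
  simp only [hfu]
  -- Q⁻¹*P*S*Q = Q⁻¹*(δ₀I - Q*R)*Q = Q - R*Q modulo the cancelled Q⁻¹, that is, A*S*Q = δ₀I - R*Q.
  have hA : sys.A.mulVec (S.mulVec v) = Y - R.mulVec v := by
    have hPS : sys.P * S = 1 - sys.Q * R := eq_sub_of_add_eq' hRS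
    rw [A, Matrix.mulVec_mulVec, Matrix.mul_assoc, hPS, mul_sub, ← mul_assoc, sys.Qinv_mul_Q,
      mul_one, one_mul, Matrix.sub_mulVec, Matrix.mulVec_mulVec, sys.Qinv_mul_Q, Matrix.one_mulVec]
  have h1 := hu i
  rw [hA] at h1
  have h2 := concNonpos.mulVec_mem hR hy.2 i
  have := concNonpos.neg_mem (concNonpos.add_mem h1 h2)
  convert this using 1
  simp only [Pi.sub_apply, v, Y]
  ring

end PseudoRationalSystem

/-! ### Pairing a convolution with a test function -/

namespace RadonPlus

theorem continuous_integral_add (μ : Measure ℝ) [IsLocallyFiniteMeasure μ]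
    (φ : 𝓓((⊤ : TopologicalSpace.Opens ℝ), ℝ)) : Continuous fun x => ∫ y, φ (x + y) ∂μ := by
  obtain ⟨C, hC⟩ := φ.hasCompactSupport.isBounded.subset_closedBall 0
  rw [continuous_iff_continuousAt]
  intro x₀
  refine ContinuousOn.continuousAt (s := Metric.closedBall x₀ 1) ?_
    (Metric.closedBall_mem_nhds x₀ one_pos)
  -- If |x - x₀| ≤ 1 and |x + y| ≤ C, then |y + x₀| ≤ C + 1.
  refine continuousOn_integral_of_compact_support (isCompact_closedBall (-x₀) (C + 1))
    (φ.continuous.comp (by fun_prop)).continuousOn ?_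
  intro x y hx hy
  by_contra hne
  have h1 := hC (subset_tsupport _ hne)
  apply hy
  rw [Metric.mem_closedBall, Real.dist_eq, abs_le] at *
  constructor <;> linarith

theorem integrable_integral_add (μ ν : PosRadon) (φ : 𝓓((⊤ : TopologicalSpace.Opens ℝ), ℝ)) :
    Integrable (fun x => ∫ y, φ (x + y) ∂μ.toMeasure) ν.toMeasure := by
  have h : Integrable (fun t => φ t) (ν * μ).toMeasure :=
    φ.continuous.integrable_of_hasCompactSupport φ.hasCompactSupport
  rw [PosRadon.toMeasure_mul, Measure.conv, integrable_map_measure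
    φ.continuous.aestronglyMeasurable (by fun_prop)] at h
  exact h.integral_prod_left

theorem integral_mul (μ ν : PosRadon) (φ : 𝓓((⊤ : TopologicalSpace.Opens ℝ), ℝ)) :
    ∫ t, φ t ∂(μ * ν).toMeasure = ∫ x, ∫ y, φ (x + y) ∂μ.toMeasure ∂ν.toMeasure := by
  rw [mul_comm]
  exact integral_conv (φ.continuous.integrable_of_hasCompactSupport
    (μ := (ν * μ).toMeasure) φ.hasCompactSupport)

/-- Testing `α * β` against `φ` amounts to integrating against `β` a continuous function which
depends only on `α` and `φ`. -/
theorem exists_continuous_toDistribution_mul (α : RadonPlus)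
    (φ : 𝓓((⊤ : TopologicalSpace.Opens ℝ), ℝ)) : ∃ ψ : ℝ → ℝ, Continuous ψ ∧
      (∀ ν : PosRadon, Integrable ψ ν.toMeasure) ∧ ∀ μ ν : PosRadon,
        (α * diff μ ν).toDistribution φ = ∫ t, ψ t ∂μ.toMeasure - ∫ t, ψ t ∂ν.toMeasure := by
  induction α using ind with
  | h μ₁ μ₂ =>
    refine ⟨fun x => ∫ y, φ (x + y) ∂μ₁.toMeasure - ∫ y, φ (x + y) ∂μ₂.toMeasure,
      (continuous_integral_add _ φ).sub (continuous_integral_add _ φ),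
      fun ν => (integrable_integral_add μ₁ ν φ).sub (integrable_integral_add μ₂ ν φ),
      fun μ ν => ?_⟩
    rw [diff_mul_diff, toDistribution_diff,
      integral_sub (integrable_integral_add _ _ φ) (integrable_integral_add _ _ φ),
      integral_sub (integrable_integral_add _ _ φ) (integrable_integral_add _ _ φ)]
    simp only [← posDistribution_apply, posDistribution_add, add_apply]
    simp only [posDistribution_apply, integral_mul]
    ring

/-- The function `ψ` such that `⟨α * β, φ⟩ = ∫ ψ dβ`. -/
noncomputable def adjointTest (α : RadonPlus) (φ : 𝓓((⊤ : TopologicalSpace.Opens ℝ), ℝ)) :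
    ℝ → ℝ :=
  (exists_continuous_toDistribution_mul α φ).choose

theorem continuous_adjointTest (α : RadonPlus) (φ : 𝓓((⊤ : TopologicalSpace.Opens ℝ), ℝ)) :
    Continuous (adjointTest α φ) :=
  (exists_continuous_toDistribution_mul α φ).choose_spec.1

theorem integrable_adjointTest (α : RadonPlus) (φ : 𝓓((⊤ : TopologicalSpace.Opens ℝ), ℝ))
    (ν : PosRadon) : Integrable (adjointTest α φ) ν.toMeasure :=
  (exists_continuous_toDistribution_mul α φ).choose_spec.2.1 ν

theorem toDistribution_mul_diff (α : RadonPlus) (φ : 𝓓((⊤ : TopologicalSpace.Opens ℝ), ℝ))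
    (μ ν : PosRadon) : (α * diff μ ν).toDistribution φ =
      ∫ t, adjointTest α φ t ∂μ.toMeasure - ∫ t, adjointTest α φ t ∂ν.toMeasure :=
  (exists_continuous_toDistribution_mul α φ).choose_spec.2.2 μ ν

theorem adjointTest_zero (α : RadonPlus) (φ : 𝓓((⊤ : TopologicalSpace.Opens ℝ), ℝ)) :
    adjointTest α φ 0 = α.toDistribution φ := by
  have h := toDistribution_mul_diff α φ 1 0
  rw [← one_def, mul_one] at h
  rw [h]
  simp

theorem toDistribution_mul_toRadon (α : RadonPlus) (φ : 𝓓((⊤ : TopologicalSpace.Opens ℝ), ℝ))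
    (f : LocL1) : (α * f.toRadon).toDistribution φ = ∫ t, adjointTest α φ t * f.toFun t := by
  have hm : AEMeasurable f.toFun volume := f.locallyIntegrable.aestronglyMeasurable.aemeasurable
  have key : ∀ g : LocL1, AEMeasurable g.toFun volume →
      Integrable (fun t => max (g.toFun t) 0 * adjointTest α φ t) volume ∧
      ∫ t, adjointTest α φ t ∂g.posMeasure.toMeasure =
        ∫ t, max (g.toFun t) 0 * adjointTest α φ t := by
    intro g hg
    have h1 : ∀ᵐ t : ℝ ∂volume, ENNReal.ofReal (g.toFun t) < ⊤ :=
      Filter.Eventually.of_forall fun t => ENNReal.ofReal_lt_top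
    have hi := integrable_adjointTest α φ g.posMeasure
    constructor
    · have := (integrable_withDensity_iff_integrable_smul₀' hg.ennreal_ofReal h1).1 hi
      simpa only [ENNReal.toReal_ofReal', smul_eq_mul] using this
    · have := integral_withDensity_eq_integral_toReal_smul₀ hg.ennreal_ofReal h1
        (adjointTest α φ)
      simp only [ENNReal.toReal_ofReal', smul_eq_mul] at this
      exact this
  obtain ⟨h1, h2⟩ := key f hm
  obtain ⟨h3, h4⟩ := key f.neg hm.neg
  rw [LocL1.toRadon, toDistribution_mul_diff, h2, h4, ← integral_sub h1 h3]
  congr 1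
  ext t
  simp only [LocL1.neg, Pi.neg_apply]
  rw [← sub_mul, mul_comm]
  congr 1
  rcases le_total (f.toFun t) 0 with h | h
  · rw [max_eq_right h, max_eq_left (by linarith)]; ring
  · rw [max_eq_left h, max_eq_right (by linarith)]; ring

end RadonPlus

/-! ### Bounded solvability and weak limits -/

/-- If a family of continuous linear equations `Λ i (u, w) = 0` has a solution `u` for every `w`,
then `u` may be chosen with norm at most a constant times the norm of `w`. -/
theorem exists_bounded_solution {ι E F : Type*} [NormedAddCommGroup E] [NormedSpace ℝ E]
    [CompleteSpace E] [NormedAddCommGroup F] [NormedSpace ℝ F] [CompleteSpace F]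
    (Λ : ι → (E × F) →L[ℝ] ℝ) (h : ∀ w, ∃ u, ∀ i, Λ i (u, w) = 0) :
    ∃ C : ℝ, ∀ w, ∃ u, (∀ i, Λ i (u, w) = 0) ∧ ‖u‖ ≤ C * ‖w‖ := by
  -- The solution pairs form a closed subspace, hence a Banach space, and its projection to F is
  -- onto; the open mapping theorem applies.
  let G : Submodule ℝ (E × F) := ⨅ i, (Λ i).toLinearMap.ker
  have hG : ∀ p, p ∈ G ↔ ∀ i, Λ i p = 0 := fun p => by
    simp [G, Submodule.mem_iInf]
  have hGc : IsClosed (G : Set (E × F)) := by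
    have : (G : Set (E × F)) = ⋂ i, {p | Λ i p = 0} := by
      ext p
      simp [hG]
    rw [this]
    exact isClosed_iInter fun i => isClosed_eq (Λ i).continuous continuous_const
  have : CompleteSpace G := hGc.completeSpace_coe
  obtain ⟨C, -, hC⟩ := ((ContinuousLinearMap.snd ℝ E F).comp G.subtypeL).exists_preimage_norm_le
    (fun w => by
      obtain ⟨u, hu⟩ := h w
      exact ⟨⟨(u, w), (hG _).2 hu⟩, rfl⟩)
  refine ⟨C, fun w => ?_⟩
  obtain ⟨⟨⟨u, w'⟩, hp⟩, hw, hn⟩ := hC w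
  obtain rfl : w' = w := hw
  exact ⟨u, (hG _).1 hp, (le_max_left _ _).trans hn⟩

theorem exists_tendsto_hyperfilter_of_bounded {x : ℕ → ℝ} {M : ℝ} (h : ∀ n, |x n| ≤ M) :
    ∃ y, Filter.Tendsto x (Filter.hyperfilter ℕ) (nhds y) := by
  obtain ⟨y, -, hy⟩ := (isCompact_Icc (a := -M) (b := M)).ultrafilter_le_nhds
    ((Filter.hyperfilter ℕ).map x) (by
      rw [Filter.le_principal_iff]
      exact Filter.mem_map.2 (Filter.univ_mem' fun n => abs_le.1 (h n)))
  exact ⟨y, hy⟩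

/-- Nonnegative densities of bounded mass on a compact space converge weakly to a finite measure
along an ultrafilter. -/
theorem exists_weak_limit_of_nonneg {X : Type*} [TopologicalSpace X] [CompactSpace X] [T2Space X]
    [MeasurableSpace X] [BorelSpace X] (κ : Measure X) {f : ℕ → X → ℝ} {C : ℝ}
    (hf : ∀ n, Integrable (f n) κ) (h0 : ∀ n x, 0 ≤ f n x) (hC : ∀ n, ∫ x, f n x ∂κ ≤ C) :
    ∃ μ : Measure X, IsFiniteMeasure μ ∧ ∀ g : C(X, ℝ), Filter.Tendsto
      (fun n => ∫ x, g x * f n x ∂κ) (Filter.hyperfilter ℕ) (nhds (∫ x, g x ∂μ)) := by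
  have hb : ∀ g : C(X, ℝ), ∃ M, ∀ x, |g x| ≤ M := fun g => by
    obtain ⟨M, hM⟩ := isCompact_univ.exists_bound_of_continuousOn g.continuous.continuousOn
    exact ⟨M, fun x => hM x (mem_univ x)⟩
  have hi : ∀ (g : C(X, ℝ)) n, Integrable (fun x => g x * f n x) κ := fun g n => by
    obtain ⟨M, hM⟩ := hb g
    exact (hf n).bdd_mul g.continuous.aestronglyMeasurable (Filter.Eventually.of_forall hM)
  have hlim : ∀ g : C(X, ℝ), ∃ y, Filter.Tendsto (fun n => ∫ x, g x * f n x ∂κ)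
      (Filter.hyperfilter ℕ) (nhds y) := fun g => by
    obtain ⟨M, hM⟩ := hb g
    -- The absolute value matters when X is empty, where M may be negative.
    refine exists_tendsto_hyperfilter_of_bounded (M := |M| * C) fun n => ?_
    calc |∫ x, g x * f n x ∂κ| ≤ ∫ x, |g x * f n x| ∂κ := abs_integral_le_integral_abs
      _ ≤ ∫ x, |M| * f n x ∂κ := by
          refine integral_mono (hi g n).abs ((hf n).const_mul _) fun x => ?_
          change |g x * f n x| ≤ _
          rw [abs_mul, abs_of_nonneg (h0 n x)]
          exact mul_le_mul_of_nonneg_right ((hM x).trans (le_abs_self M)) (h0 n x)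
      _ ≤ |M| * C := by
          rw [integral_const_mul]
          exact mul_le_mul_of_nonneg_left (hC n) (abs_nonneg M)
  choose L hL using hlim
  -- One ultrafilter serves all g at once, so the limits form a linear functional; it is positive
  -- since f n ≥ 0, and Riesz–Markov–Kakutani represents it.
  let Λ₀ : CompactlySupportedContinuousMap X ℝ →ₗ[ℝ] ℝ :=
    { toFun := fun g => L g
      map_add' := fun g g' => by
        refine tendsto_nhds_unique (hL _) (((hL g).add (hL g')).congr fun n => ?_)
        rw [← integral_add (hi g n) (hi g' n)]
        refine integral_congr_ae (Filter.Eventually.of_forall fun x => ?_)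
        simp [add_mul]
      map_smul' := fun c g => by
        refine tendsto_nhds_unique (hL _) (((hL g).const_mul c).congr fun n => ?_)
        rw [← integral_const_mul]
        refine integral_congr_ae (Filter.Eventually.of_forall fun x => ?_)
        simp [mul_assoc] }
  let Λ : CompactlySupportedContinuousMap X ℝ →ₚ[ℝ] ℝ := PositiveLinearMap.mk₀ Λ₀ fun g hg =>
    ge_of_tendsto (hL g) (Filter.Eventually.of_forall fun n =>
      integral_nonneg fun x => mul_nonneg (hg x) (h0 n x))
  refine ⟨RealRMK.rieszMeasure Λ, inferInstance, fun g => ?_⟩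
  have := RealRMK.integral_rieszMeasure Λ (CompactlySupportedContinuousMap.continuousMapEquiv g)
  have h2 : ∫ x, g x ∂(RealRMK.rieszMeasure Λ) = L g := this
  rw [h2]
  exact hL g

/-! ### The spaces `L¹([a, 0])` -/

/-- The Banach space `L¹([a, 0])`. -/
abbrev L1Icc (a : ℝ) : Type := Lp ℝ 1 (volume.restrict (Icc a 0))

namespace LocL1

/-- The extension by zero of a function in `L¹([a, 0])`. -/
noncomputable def ofL1 {a : ℝ} (u : L1Icc a) : LocL1 where
  toFun := (Icc a 0).indicator u
  locallyIntegrable :=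
    ((integrable_indicator_iff measurableSet_Icc).2 (L1.integrable_coeFn u)).locallyIntegrable
  bddLeft := ⟨a, fun _ ht => indicator_of_notMem (fun h => not_lt.2 h.1 ht) _⟩

theorem ofL1_apply {a : ℝ} (u : L1Icc a) (t : ℝ) :
    (ofL1 u).toFun t = (Icc a 0).indicator u t := rfl

/-- The restriction of a locally integrable function to `[a, 0]`. -/
noncomputable def toL1 (a : ℝ) (f : LocL1) : L1Icc a :=
  (f.locallyIntegrable.integrableOn_isCompact isCompact_Icc).integrable.toL1 f.toFun

theorem toRadon_congr {f g : LocL1} (h : f.toFun =ᵐ[volume] g.toFun) : f.toRadon = g.toRadon := by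
  have h1 : f.posMeasure = g.posMeasure := PosRadon.ext
    (withDensity_congr_ae (h.mono fun t ht => by simp only [ht]))
  have h2 : f.neg.posMeasure = g.neg.posMeasure := PosRadon.ext
    (withDensity_congr_ae (h.mono fun t ht => by simp only [neg, Pi.neg_apply, ht]))
  rw [toRadon, toRadon, h1, h2]

theorem toRadon_ofL1_toL1 {a : ℝ} {f : LocL1} (h : ∀ t ∉ Icc a 0, f.toFun t = 0) :
    (ofL1 (toL1 a f)).toRadon = f.toRadon := by
  refine toRadon_congr ?_
  have h1 : (toL1 a f : ℝ → ℝ) =ᵐ[volume.restrict (Icc a 0)] f.toFun := Integrable.coeFn_toL1 _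
  filter_upwards [(ae_restrict_iff' measurableSet_Icc).1 h1] with t ht
  rw [ofL1_apply]
  by_cases hm : t ∈ Icc a 0
  · rw [indicator_of_mem hm, ht hm]
  · rw [indicator_of_notMem hm, h t hm]

/-- The function equal to `n + 1` on `[-1/(n+1), 0]` and zero elsewhere. -/
noncomputable def approxDelta (n : ℕ) : LocL1 where
  toFun := (Icc (-(1 / ((n : ℝ) + 1))) 0).indicator fun _ => (n : ℝ) + 1
  locallyIntegrable := ((integrable_indicator_iff measurableSet_Icc).2
    (integrableOn_const isCompact_Icc.measure_lt_top.ne)).locallyIntegrable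
  bddLeft := ⟨_, fun _ ht => indicator_of_notMem (fun h => not_lt.2 h.1 ht) _⟩

theorem integral_mul_approxDelta (ψ : ℝ → ℝ) (n : ℕ) :
    ∫ t, ψ t * (approxDelta n).toFun t =
      ((n : ℝ) + 1) * ∫ t in (-(1 / ((n : ℝ) + 1)))..0, ψ t := by
  have hn : -(1 / ((n : ℝ) + 1)) ≤ 0 := by
    rw [neg_nonpos]
    positivity
  rw [intervalIntegral.integral_of_le hn, ← integral_Icc_eq_integral_Ioc, ← integral_const_mul,
    ← integral_indicator measurableSet_Icc]
  congr 1
  ext t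
  by_cases ht : t ∈ Icc (-(1 / ((n : ℝ) + 1))) 0
  · simp only [approxDelta, indicator_of_mem ht]; ring
  · simp only [approxDelta, indicator_of_notMem ht, mul_zero]

/-- The integrals are difference quotients at 0 of a primitive of ψ. -/
theorem tendsto_integral_mul_approxDelta {ψ : ℝ → ℝ} (hψ : Continuous ψ) :
    Filter.Tendsto (fun n => ∫ t, ψ t * (approxDelta n).toFun t) Filter.atTop (nhds (ψ 0)) := by
  have hd : HasDerivAt (fun x => ∫ t in (0 : ℝ)..x, ψ t) (ψ 0) 0 :=
    intervalIntegral.integral_hasDerivAt_right (hψ.intervalIntegrable _ _)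
      (hψ.stronglyMeasurableAtFilter _ _) hψ.continuousAt
  have hs := hd.tendsto_slope_zero
  have hε : Filter.Tendsto (fun n : ℕ => -(1 / ((n : ℝ) + 1))) Filter.atTop
      (nhdsWithin 0 {0}ᶜ) := by
    refine tendsto_nhdsWithin_iff.2 ⟨?_, Filter.Eventually.of_forall fun n => ?_⟩
    · simpa using (tendsto_one_div_add_atTop_nhds_zero_nat (𝕜 := ℝ)).neg
    · have : (0 : ℝ) < 1 / ((n : ℝ) + 1) := by positivity
      simpa using (by positivity : (n : ℝ) + 1 ≠ 0)
  refine (hs.comp hε).congr fun n => ?_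
  rw [integral_mul_approxDelta]
  simp only [Function.comp_apply, zero_add, intervalIntegral.integral_same, sub_zero, smul_eq_mul]
  rw [inv_neg, one_div, inv_inv, intervalIntegral.integral_symm 0]
  ring

theorem approxDelta_eq_zero (n : ℕ) {t : ℝ} (ht : t ∉ Icc (-1 : ℝ) 0) :
    (approxDelta n).toFun t = 0 := by
  have h1 : 1 / ((n : ℝ) + 1) ≤ 1 :=
    (div_le_one (by positivity)).2 (by linarith [n.cast_nonneg (α := ℝ)])
  have h2 : t ∉ Icc (-(1 / ((n : ℝ) + 1))) 0 := fun h => ht ⟨by linarith [h.1], h.2⟩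
  simp only [approxDelta, indicator_of_notMem h2]

theorem norm_toL1_approxDelta_le (n : ℕ) : ‖toL1 (-1) (approxDelta n)‖ ≤ 1 := by
  have h0 : ∀ t, 0 ≤ (approxDelta n).toFun t := fun t =>
    indicator_nonneg (f := fun _ => (n : ℝ) + 1) (fun _ _ => by positivity) t
  have hi : Integrable (approxDelta n).toFun volume := (integrable_indicator_iff
    measurableSet_Icc).2 (integrableOn_const isCompact_Icc.measure_lt_top.ne)
  rw [toL1, L1.norm_of_fun_eq_integral_norm]
  calc ∫ t in Icc (-1) 0, ‖(approxDelta n).toFun t‖ ≤ ∫ t, ‖(approxDelta n).toFun t‖ :=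
        setIntegral_le_integral hi.norm (Filter.Eventually.of_forall fun t => norm_nonneg _)
    _ = ∫ t, 1 * (approxDelta n).toFun t := by
        congr 1
        ext t
        rw [one_mul, Real.norm_of_nonneg (h0 t)]
    _ = 1 := by
        rw [integral_mul_approxDelta (fun _ => 1)]
        simp only [intervalIntegral.integral_const, smul_eq_mul, mul_one, sub_neg_eq_add, zero_add]
        field_simp
    _ ≤ 1 := le_rfl

/-- With ψ = `adjointTest α φ`, this makes testing a convolution a continuous functional of the L¹
factor. -/
theorem exists_clm_integral_mul (a : ℝ) {ψ : ℝ → ℝ} (hψ : Continuous ψ) :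
    ∃ F : L1Icc a →L[ℝ] ℝ, ∀ u, F u = ∫ t in Icc a 0, ψ t * u t := by
  obtain ⟨M, hM⟩ := (isCompact_Icc (a := a) (b := 0)).exists_bound_of_continuousOn
    hψ.continuousOn
  have hi : ∀ u : L1Icc a, Integrable (fun t => ψ t * u t) (volume.restrict (Icc a 0)) :=
    fun u => (L1.integrable_coeFn u).bdd_mul hψ.aestronglyMeasurable
      ((ae_restrict_iff' measurableSet_Icc).2 (Filter.Eventually.of_forall hM))
  refine ⟨LinearMap.mkContinuous
    { toFun := fun u => ∫ t in Icc a 0, ψ t * u t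
      map_add' := fun u v => ?_
      map_smul' := fun c u => ?_ } M fun u => ?_, fun u => rfl⟩
  · rw [← integral_add (hi u) (hi v)]
    refine integral_congr_ae ((Lp.coeFn_add u v).mono fun t ht => ?_)
    simp only [ht, Pi.add_apply, mul_add]
  · rw [RingHom.id_apply, smul_eq_mul, ← integral_const_mul]
    refine integral_congr_ae ((Lp.coeFn_smul c u).mono fun t ht => ?_)
    simp only [ht, Pi.smul_apply, smul_eq_mul]
    ring
  · change ‖∫ t in Icc a 0, ψ t * u t‖ ≤ _
    rw [L1.norm_eq_integral_norm, ← integral_const_mul]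
    refine (norm_integral_le_integral_norm _).trans (integral_mono_ae (hi u).norm
      ((L1.integrable_coeFn u).norm.const_mul M) ?_)
    refine (ae_restrict_iff' measurableSet_Icc).2 (Filter.Eventually.of_forall fun t ht => ?_)
    simp only [norm_mul]
    exact mul_le_mul_of_nonneg_right (hM t ht) (norm_nonneg _)

theorem toDistribution_mul_ofL1 (α : RadonPlus) (φ : 𝓓((⊤ : TopologicalSpace.Opens ℝ), ℝ)) {a : ℝ}
    (u : L1Icc a) : (α * (ofL1 u).toRadon).toDistribution φ =
      ∫ t in Icc a 0, RadonPlus.adjointTest α φ t * u t := by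
  rw [RadonPlus.toDistribution_mul_toRadon, ← integral_indicator measurableSet_Icc]
  congr 1
  ext t
  rw [ofL1_apply, indicator_mul_right]

/-- Bounded sequences in `L¹([a, 0])` converge weakly to a real measure on `[a, 0]` along an
ultrafilter. -/
theorem exists_weak_limit {a C : ℝ} (u : ℕ → L1Icc a) (hC : ∀ n, ‖u n‖ ≤ C) :
    ∃ σ : RadonPlus, σ.ConcOn (Icc a 0) ∧
      ∀ (α : RadonPlus) (φ : 𝓓((⊤ : TopologicalSpace.Opens ℝ), ℝ)), Filter.Tendsto
        (fun n => (α * (ofL1 (u n)).toRadon).toDistribution φ) (Filter.hyperfilter ℕ)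
        (nhds ((α * σ).toDistribution φ)) := by
  -- The signs s = 1 and s = -1 give the limits of the positive and the negative parts of u n.
  have key : ∀ s : ℝ, |s| = 1 → ∃ μ : PosRadon, μ.toMeasure (Icc a 0)ᶜ = 0 ∧
      ∀ ψ : ℝ → ℝ, Continuous ψ → Filter.Tendsto
        (fun n => ∫ t in Icc a 0, ψ t * max (s * u n t) 0) (Filter.hyperfilter ℕ)
        (nhds (∫ t, ψ t ∂μ.toMeasure)) := by
    intro s hs
    have hi : ∀ n, IntegrableOn (fun t => max (s * u n t) 0) (Icc a 0) := fun n =>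
      ((L1.integrable_coeFn (u n)).const_mul s).pos_part
    obtain ⟨μ, hμ, hl⟩ := exists_weak_limit_of_nonneg (X := Icc a (0 : ℝ))
      (Measure.comap Subtype.val volume) (f := fun n t => max (s * u n t) 0) (C := C)
      (fun n => (integrableOn_iff_comap_subtypeVal measurableSet_Icc).1 (hi n))
      (fun n t => le_max_right _ _) (fun n => by
        rw [integral_subtype_comap measurableSet_Icc (fun t : ℝ => max (s * u n t) 0)]
        refine le_trans ?_ (hC n)
        rw [L1.norm_eq_integral_norm]
        refine integral_mono (hi n) (L1.integrable_coeFn (u n)).norm fun t => ?_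
        refine max_le ((le_abs_self _).trans ?_) (norm_nonneg _)
        rw [abs_mul, hs, one_mul, Real.norm_eq_abs])
    refine ⟨⟨μ.map Subtype.val, inferInstance, a, ?_⟩, ?_, fun ψ hψ => ?_⟩
    · rw [Measure.map_apply measurable_subtype_coe measurableSet_Iio]
      convert measure_empty (μ := μ)
      ext x
      simpa using x.2.1
    · change (μ.map Subtype.val) _ = 0
      rw [Measure.map_apply measurable_subtype_coe measurableSet_Icc.compl]
      convert measure_empty (μ := μ)
      ext x
      simp
    · have := hl ⟨fun x => ψ x, by fun_prop⟩
      change Filter.Tendsto _ _ (nhds (∫ t, ψ t ∂(μ.map Subtype.val)))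
      rw [integral_map measurable_subtype_coe.aemeasurable hψ.aestronglyMeasurable]
      refine this.congr fun n => ?_
      exact integral_subtype_comap measurableSet_Icc (fun t : ℝ => ψ t * max (s * u n t) 0)
  obtain ⟨μ, hμ, hμl⟩ := key 1 (by simp)
  obtain ⟨ν, hν, hνl⟩ := key (-1) (by simp)
  refine ⟨RadonPlus.diff μ ν, RadonPlus.concOn_diff hμ hν, fun α φ => ?_⟩
  have hψ := RadonPlus.continuous_adjointTest α φ
  rw [RadonPlus.toDistribution_mul_diff]
  refine ((hμl _ hψ).sub (hνl _ hψ)).congr fun n => ?_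
  obtain ⟨M, hM⟩ := (isCompact_Icc (a := a) (b := 0)).exists_bound_of_continuousOn
    hψ.continuousOn
  have hi : ∀ s : ℝ, Integrable (fun t => RadonPlus.adjointTest α φ t * max (s * u n t) 0)
      (volume.restrict (Icc a 0)) := fun s =>
    (((L1.integrable_coeFn (u n)).const_mul s).pos_part).bdd_mul hψ.aestronglyMeasurable
      ((ae_restrict_iff' measurableSet_Icc).2 (Filter.Eventually.of_forall hM))
  rw [toDistribution_mul_ofL1, ← integral_sub (hi 1) (hi (-1))]
  congr 1
  ext t
  rw [← mul_sub, one_mul, neg_one_mul]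
  congr 1
  rcases le_total (u n t) 0 with h | h
  · rw [max_eq_right h, max_eq_left (by linarith)]; ring
  · rw [max_eq_left h, max_eq_right (by linarith)]; ring

end LocL1

/-! ### Reachable systems are left-coprime -/

namespace RadonPlus

theorem mem_concNonpos_iff_toDistribution {α : RadonPlus} :
    α ∈ concNonpos ↔ ∀ φ : testPlus, α.toDistribution φ = 0 := by
  rw [← trunc_eq_zero_iff]
  exact ContinuousLinearMap.ext_iff

end RadonPlus

namespace PseudoRationalSystem

open RadonPlus

variable {d m : ℕ}

/-- The part y of Q⁻¹*(w e_j) on (0, ∞) is a state: Q*y differs from w e_j by Q times a measure on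
(-∞, 0]. -/
theorem ReachableInTime.exists_input {sys : PseudoRationalSystem d m} {T : ℝ}
    (h : sys.ReachableInTime T) (j : Fin d) (w : LocL1) (hw : w.toRadon ∈ concNonpos) :
    ∃ u : Fin m → LocL1, (∀ k, u k ∈ LocL1.OmegaIn T) ∧
      ∀ i, sys.A.mulVec (fun k => (u k).toRadon) i - sys.Qinv i j * w.toRadon ∈ concNonpos := by
  have hac : ∀ i, AbsCont (restr (Ioi 0) (sys.Qinv i j * w.toRadon)) := fun i =>
    ((absCont_toRadon w).mul_left _).restr _
  have hy : ∀ i, ∃ f : LocL1, f.toRadon = restr (Ioi 0) (sys.Qinv i j * w.toRadon) ∧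
      ∀ t ∉ Ioi (0 : ℝ), f.toFun t = 0 := fun i =>
    (hac i).exists_locL1 measurableSet_Ioi Ioi_subset_Ici_self (concOn_restr measurableSet_Ioi _)
  choose y hyr hy0 using hy
  have hsplit : ∀ i, sys.Qinv i j * w.toRadon - (y i).toRadon =
      restr (Iic 0) (sys.Qinv i j * w.toRadon) := fun i => by
    rw [hyr, ← compl_Iic, sub_eq_iff_eq_add, restr_add_restr_compl measurableSet_Iic]
  have hneg : ∀ i, sys.Qinv i j * w.toRadon - (y i).toRadon ∈ concNonpos := fun i => by
    rw [hsplit]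
    exact concOn_restr measurableSet_Iic _
  have hstate : y ∈ sys.stateSpace := by
    rw [stateSpace_mem_iff]
    refine ⟨fun i t ht => hy0 i t (not_lt.2 ht.le), fun i => ?_⟩
    have hQ : sys.Q.mulVec (fun i => sys.Qinv i j * w.toRadon) i ∈ concNonpos := by
      have : sys.Q.mulVec (fun i => sys.Qinv i j * w.toRadon) i =
          (1 : Matrix (Fin d) (Fin d) RadonPlus) i j * w.toRadon := by
        rw [← sys.Q_mul_Qinv, Matrix.mul_apply, Finset.sum_mul, Matrix.mulVec, dotProduct]
        exact Finset.sum_congr rfl fun k _ =>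
          (mul_assoc (sys.Q i k) (sys.Qinv k j) w.toRadon).symm
      rw [this]
      refine concNonpos.mul_mem ?_ hw
      rw [Matrix.one_apply]
      split_ifs
      exacts [concNonpos.one_mem, concNonpos.zero_mem]
    have hK := concNonpos.mulVec_mem sys.Q_mem_concNonpos hneg i
    have hs : (fun i => sys.Qinv i j * w.toRadon - (y i).toRadon) =
        (fun i => sys.Qinv i j * w.toRadon) - fun i => (y i).toRadon := rfl
    rw [hs, Matrix.mulVec_sub, Pi.sub_apply] at hK
    simpa using concNonpos.sub_mem hQ hK
  obtain ⟨u, hu, hr⟩ := h y hstate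
  refine ⟨u, hu, fun i => ?_⟩
  simpa using concNonpos.sub_mem (trunc_eq_trunc_iff.1 (hr i)) (hneg i)

/-- In a reachable system the inputs can be chosen to depend boundedly on the data. -/
theorem ReachableInTime.exists_bounded_input {sys : PseudoRationalSystem d m} {T : ℝ}
    (h : sys.ReachableInTime T) (j : Fin d) : ∃ C : ℝ, ∀ w : L1Icc (-1),
      ∃ u : Fin m → L1Icc (-T), ‖u‖ ≤ C * ‖w‖ ∧ ∀ i, ∀ φ ∈ testPlus,
        ∑ k, (sys.A i k * (LocL1.ofL1 (u k)).toRadon).toDistribution φ =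
          (sys.Qinv i j * (LocL1.ofL1 w).toRadon).toDistribution φ := by
  choose F hF using fun i k φ =>
    LocL1.exists_clm_integral_mul (-T) (continuous_adjointTest (sys.A i k) φ)
  choose H hH using fun i φ =>
    LocL1.exists_clm_integral_mul (-1) (continuous_adjointTest (sys.Qinv i j) φ)
  -- One scalar equation for each output coordinate and each test function.
  let Λ : Fin d × testPlus → ((Fin m → L1Icc (-T)) × L1Icc (-1)) →L[ℝ] ℝ := fun p =>
    (∑ k, (F p.1 k p.2).comp (ContinuousLinearMap.proj k)).comp
      (ContinuousLinearMap.fst ℝ _ _) - (H p.1 p.2).comp (ContinuousLinearMap.snd ℝ _ _)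
  have hΛ : ∀ i φ u w, Λ (i, φ) (u, w) =
      ∑ k, (sys.A i k * (LocL1.ofL1 (u k)).toRadon).toDistribution φ -
        (sys.Qinv i j * (LocL1.ofL1 w).toRadon).toDistribution φ := by
    intro i φ u w
    simp [Λ, LocL1.toDistribution_mul_ofL1, hF, hH]
  obtain ⟨C, hC⟩ := exists_bounded_solution Λ fun w => by
    have hw : (LocL1.ofL1 w).toRadon ∈ concNonpos :=
      concOn_toRadon measurableSet_Iic fun t ht => by
        rw [LocL1.ofL1_apply]
        exact indicator_of_notMem (fun hm => ht hm.2) _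
    obtain ⟨u, hu, hr⟩ := h.exists_input j _ hw
    refine ⟨fun k => LocL1.toL1 (-T) (u k), fun ⟨i, φ⟩ => ?_⟩
    rw [hΛ]
    have := mem_concNonpos_iff_toDistribution.1 (hr i) φ
    rw [toDistribution_sub, Matrix.mulVec, dotProduct, toDistribution_sum] at this
    rw [← this]
    congr 1
    exact Finset.sum_congr rfl fun k _ => by rw [LocL1.toRadon_ofL1_toL1 (hu k)]
  refine ⟨C, fun w => ?_⟩
  obtain ⟨u, hu, hn⟩ := hC w
  refine ⟨u, hn, fun i φ hφ => ?_⟩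
  have := hu (i, ⟨φ, hφ⟩)
  rwa [hΛ, sub_eq_zero] at this

/-- σ is a weak limit of bounded inputs answering w = `approxDelta n`; the tested equations pass to
the limit, where w becomes δ₀. -/
theorem ReachableInTime.exists_column {sys : PseudoRationalSystem d m} {T : ℝ}
    (h : sys.ReachableInTime T) (j : Fin d) : ∃ σ : Fin m → RadonPlus,
      (∀ k, σ k ∈ concNonpos) ∧ ∀ i, sys.Qinv i j - sys.A.mulVec σ i ∈ concNonpos := by
  obtain ⟨C, hC⟩ := h.exists_bounded_input j
  choose u hu hr using fun n => hC (LocL1.toL1 (-1) (LocL1.approxDelta n))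
  have hb : ∀ k n, ‖u n k‖ ≤ |C| := fun k n =>
    calc ‖u n k‖ ≤ ‖u n‖ := norm_le_pi_norm _ k
      _ ≤ C * ‖LocL1.toL1 (-1) (LocL1.approxDelta n)‖ := hu n
      _ ≤ |C| * 1 := mul_le_mul (le_abs_self C) (LocL1.norm_toL1_approxDelta_le n)
          (norm_nonneg _) (abs_nonneg C)
      _ = |C| := mul_one _
  choose σ hσ hlim using fun k => LocL1.exists_weak_limit (fun n => u n k) (hb k)
  refine ⟨σ, fun k => (hσ k).mono measurableSet_Icc Icc_subset_Iic_self, fun i => ?_⟩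
  rw [mem_concNonpos_iff_toDistribution]
  intro φ
  rw [toDistribution_sub, sub_eq_zero, Matrix.mulVec, dotProduct, toDistribution_sum]
  have h1 := tendsto_finsetSum Finset.univ fun k _ => hlim k (sys.A i k) φ
  have h2 := (LocL1.tendsto_integral_mul_approxDelta
    (continuous_adjointTest (sys.Qinv i j) φ)).mono_left Nat.hyperfilter_le_atTop
  rw [adjointTest_zero] at h2
  refine tendsto_nhds_unique h2 (h1.congr fun n => ?_)
  rw [hr n i φ φ.2, LocL1.toRadon_ofL1_toL1 fun t ht => LocL1.approxDelta_eq_zero n ht,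
    toDistribution_mul_toRadon]

theorem ReachableInTime.leftCoprime {sys : PseudoRationalSystem d m} {T : ℝ}
    (h : sys.ReachableInTime T) : sys.LeftCoprime := by
  choose σ hσ hR using h.exists_column
  let S : Matrix (Fin m) (Fin d) RadonPlus := Matrix.of fun k j => σ j k
  -- With this R the Bézout identity is automatic; the content is that R lies over M(ℝ₋).
  refine ⟨sys.Qinv - sys.A * S, S, fun i j => mem_MMinus_iff.2 (hR j i),
    fun k j => mem_MMinus_iff.2 (hσ j k), ?_⟩
  rw [mul_sub, sys.Q_mul_Qinv, A, ← Matrix.mul_assoc, ← Matrix.mul_assoc, sys.Q_mul_Qinv,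
    Matrix.one_mul, sub_add_cancel]

end PseudoRationalSystem

/-- For `T > -l(det Q)`, a pseudo-rational system of order zero is `X^{Q,1}`-reachable in time `T`
if and only if it is left-coprime. -/
theorem theorem2 {d m : ℕ} (sys : PseudoRationalSystem d m) (T : ℝ)
    (hT : -(RadonPlus.l sys.Q.det) < T) :
    sys.ReachableInTime T ↔ sys.LeftCoprime :=
  ⟨fun h => h.leftCoprime, fun h => h.reachableInTime hT.le⟩
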